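/- **Setting.** All alphabets are finite. A pair of sources $(S_1,S_2)$ with joint pmf $P$ is *transmissible* over a two-user interference channel (IC) $W(y_1,y_2|x_1,x_2)$ if for every $\varepsilon>0$ and all sufficiently large $n$ there are encoders $e_j:\mathcal S_j^n\to\mathcal X_j^n$ and decoders $d_j:\mathcal Y_j^n\to\mathcal S_j^n$ ($j=1,2$) such that, for $n$ i.i.d. source pairs and $n$ memoryless uses of $W$, $\Pr\big(d_1(Y_1^n)\ne S_1^n\text{ or }d_2(Y_2^n)\neq S_2^n\big)\le\varepsilon$. Let $K=f(S_1)=g(S_2)$ be the Gács–Körner–Witsenhausen common part of the sources, i.e. the (a.s.) common function of $S_1$ and of $S_2$ that determines every other one. The *Liu–Chen (LC) conditions* hold if there are finite-alphabet auxiliary variables with joint pmf $P(s_1,s_2)\,p(q)\,p(w_1|q)\,p(w_2|q)\,p(x_1|s_1,w_1,q)\,p(x_2|s_2,w_2,q)\,W(y_1,y_2|x_1,x_2)$ such that, writing for $\{j,i\}=\{1,2\}$ $$\begin{aligned}&a_j=I(S_jX_j;Y_j|KQW_1W_2),\quad d_j=I(S_jX_j;Y_j|KQW_i),\quad e_j=I(W_iS_jX_j;Y_j|KQW_j),\\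 &g_j=I(W_iS_jX_j;Y_j|KQ),\quad h_j=I(QW_iS_jX_j;Y_j),\qquad r_j=H(S_j|K),\end{aligned}$$ one has $r_1+r_2\le e_1+e_2$ and, for both choices of $(j,i)$, $$\begin{aligned}&r_j\le d_j,\quad H(S_j)\le h_j,\quad r_j+r_i\le a_j+g_i,\quad r_j+H(S_i)\le a_j+h_i,\\ &2r_j+r_i\le a_j+g_j+e_i,\quad H(S_j)+r_j+r_i\le a_j+h_j+e_i.\end{aligned}$$ **Example.** Let $\eta\ge 8$ be an even integer, and $a,k$ positive integers. Let $\mathcal S_1=\mathcal S_2=\{0,\dots,a-1\}^k$ and $$P(c^k,d^k)=\begin{cases}\frac{k-1}{k}& c^k=d^k=0^k,\\ \frac{a^{\eta k}-1}{k a^{\eta k}(a^k-1)}& c^k=d^k\ne 0^k,\\ \frac{1}{k a^{\eta k}(a^k-1)}& c^k=0^k,\ d^k\ne0^k,\\ 0&\text{otherwise.}\end{cases}$$ Encoder $j$ inputs $(U_j,X_j)\in\{0,\dots,a-1\}\times\mathcal X_j$ and decoder $j$ receives $(Y_0,Y_j)$, where $Y_0\in\{0,\dots,a-1\}$ is the same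 at both decoders, and the channel is $W_{Y_1|X_1}W_{Y_2|X_2}W_{Y_0|U_1U_2}$. Here $Y_0=U_1$ if $U_1=U_2$ and $Y_0=0$ if $U_1\ne U_2$, and $W_{Y_1|X_1}$, $W_{Y_2|X_2}$ are any finite-alphabet channels with capacities $\mathcal C=h_b(\frac2k)+\frac2k\log a$ and $\mathcal C+h_b(\frac{2}{ka^{\eta k}})$ respectively, where $h_b$ is the binary entropy function. **Theorem.** The LC conditions are not necessary for transmissibility: there are sources and an IC for which the sources are transmissible over the IC but the LC conditions fail. Specifically, for every even $\eta\ge8$ there are $a^*,k^*\in\mathbb N$ such that for all $a\ge a^*$ and all $k\ge k^*$ (and all satellite channels as above) the sources and the IC of the example do not satisfy the LC conditions, and yet the sources are transmissible over the IC. -/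

import Mathlib

noncomputable section

/-- `V` is a stochastic matrix: `V x y` is the probability of output `y` given input `x`. -/
def IsChannel {X Y : Type*} [Fintype Y] (V : X → Y → ℝ) : Prop :=
  ∀ x, V x ∈ stdSimplex ℝ Y

/-! ### Information measures (in nats) of random variables on a finite probability space -/

open scoped Classical in
/-- Shannon entropy `H(A)` of the random variable `A` when outcomes are drawn from `p`. -/
def entropy {Ω α : Type*} [Fintype Ω] [Fintype α] (p : Ω → ℝ) (A : Ω → α) : ℝ :=
  ∑ a, Real.negMulLog (∑ ω with A ω = a, p ω)

/-- Conditional entropy `H(A | C)`. -/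
def condEntropy {Ω α γ : Type*} [Fintype Ω] [Fintype α] [Fintype γ]
    (p : Ω → ℝ) (A : Ω → α) (C : Ω → γ) : ℝ :=
  entropy p (fun ω => (A ω, C ω)) - entropy p C

/-- Mutual information `I(A ; B)`. -/
def mutualInfo {Ω α β : Type*} [Fintype Ω] [Fintype α] [Fintype β]
    (p : Ω → ℝ) (A : Ω → α) (B : Ω → β) : ℝ :=
  entropy p A - condEntropy p A B

/-- Conditional mutual information `I(A ; B | C)`. -/
def condMutualInfo {Ω α β γ : Type*} [Fintype Ω] [Fintype α] [Fintype β] [Fintype γ]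
    (p : Ω → ℝ) (A : Ω → α) (B : Ω → β) (C : Ω → γ) : ℝ :=
  condEntropy p A C - condEntropy p A (fun ω => (B ω, C ω))

/-- Capacity of the point-to-point discrete memoryless channel `V`:
the supremum of `I(X ; Y)` over all input distributions. -/
def capacity {X Y : Type*} [Fintype X] [Fintype Y] (V : X → Y → ℝ) : ℝ :=
  ⨆ p : stdSimplex ℝ X,
    mutualInfo (fun z : X × Y => (p : X → ℝ) z.1 * V z.1 z.2) Prod.fst Prod.snd

/-! ### Lossless transmission of two correlated sources over a two-user interference channel -/

section Transmission

variable {S₁ S₂ X₁ X₂ Y₁ Y₂ : Type*}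
  [Fintype S₁] [Fintype S₂] [Fintype X₁] [Fintype X₂] [Fintype Y₁] [Fintype Y₂]

open scoped Classical in
/-- Probability that at least one of the two decoders errs, when `n` i.i.d. source pairs of law `P`
are sent in `n` uses of the memoryless interference channel `W` with encoders `e₁, e₂` and
decoders `d₁, d₂`. -/
def errorProb (P : S₁ × S₂ → ℝ) (W : X₁ × X₂ → Y₁ × Y₂ → ℝ) {n : ℕ}
    (e₁ : (Fin n → S₁) → (Fin n → X₁)) (e₂ : (Fin n → S₂) → (Fin n → X₂))
    (d₁ : (Fin n → Y₁) → (Fin n → S₁)) (d₂ : (Fin n → Y₂) → (Fin n → S₂)) : ℝ :=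
  ∑ s₁ : Fin n → S₁, ∑ s₂ : Fin n → S₂, ∑ y₁ : Fin n → Y₁, ∑ y₂ : Fin n → Y₂,
    if d₁ y₁ = s₁ ∧ d₂ y₂ = s₂ then 0
    else (∏ i, P (s₁ i, s₂ i)) * ∏ i, W (e₁ s₁ i, e₂ s₂ i) (y₁ i, y₂ i)

/-- The source pair with law `P` is transmissible over the interference channel `W`: block codes
with arbitrarily small error probability exist for all sufficiently large block-lengths. -/
def Transmissible (P : S₁ × S₂ → ℝ) (W : X₁ × X₂ → Y₁ × Y₂ → ℝ) : Prop :=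
  ∀ ε : ℝ, 0 < ε → ∀ᶠ n : ℕ in Filter.atTop,
    ∃ (e₁ : (Fin n → S₁) → (Fin n → X₁)) (e₂ : (Fin n → S₂) → (Fin n → X₂))
      (d₁ : (Fin n → Y₁) → (Fin n → S₁)) (d₂ : (Fin n → Y₂) → (Fin n → S₂)),
      errorProb P W e₁ e₂ d₁ d₂ ≤ ε

end Transmission

/-! ### The Liu–Chen conditions -/

/-- `K = f(S₁) = g(S₂)` is the Gács–Körner–Witsenhausen common part of the source pair with law
`P`: it is a common function (almost surely), and it determines every other common function. -/
def IsCommonPart {S₁ S₂ κ : Type*} (P : S₁ × S₂ → ℝ) (f : S₁ → κ) (g : S₂ → κ) : Prop :=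
  (∀ s₁ s₂, 0 < P (s₁, s₂) → f s₁ = g s₂) ∧
  ∀ (n : ℕ) (f' : S₁ → Fin n) (g' : S₂ → Fin n),
    (∀ s₁ s₂, 0 < P (s₁, s₂) → f' s₁ = g' s₂) →
    ∀ s₁ s₂ t₁ t₂, 0 < P (s₁, s₂) → 0 < P (t₁, t₂) → f s₁ = f t₁ → f' s₁ = f' t₁

/-- The Liu–Chen inequalities for random variables on the finite probability space `(Ω, p)`.
Here `K` is the common part of the sources, `Q` the auxiliary variable available to both encoders,
and `Wⱼ` the part of encoder `j`'s signal that both receivers decode. When `K` is constant,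
`sum_a1_g2` reads
`H(S₁,S₂) ≤ I(S₁X₁;Y₁|QW₁W₂) + I(W₁S₂X₂;Y₂|Q) - I(S₁;S₂)`. The inequalities are not strict, so
that a violation of them is also a violation of their strict form. -/
structure LCInequalities {Ω S₁ S₂ κ θ W₁ W₂ X₁ X₂ Y₁ Y₂ : Type*} [Fintype Ω] [Fintype S₁]
    [Fintype S₂] [Fintype κ] [Fintype θ] [Fintype W₁] [Fintype W₂] [Fintype X₁] [Fintype X₂]
    [Fintype Y₁] [Fintype Y₂] (p : Ω → ℝ)
    (s₁ : Ω → S₁) (s₂ : Ω → S₂) (K : Ω → κ) (Q : Ω → θ) (w₁ : Ω → W₁) (w₂ : Ω → W₂)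
    (x₁ : Ω → X₁) (x₂ : Ω → X₂) (y₁ : Ω → Y₁) (y₂ : Ω → Y₂) : Prop where
  single_d1 : condEntropy p s₁ K ≤
    condMutualInfo p (fun ω => (s₁ ω, x₁ ω)) y₁ (fun ω => (K ω, Q ω, w₂ ω))
  single_d2 : condEntropy p s₂ K ≤
    condMutualInfo p (fun ω => (s₂ ω, x₂ ω)) y₂ (fun ω => (K ω, Q ω, w₁ ω))
  single_h1 : entropy p s₁ ≤ mutualInfo p (fun ω => (Q ω, s₁ ω, x₁ ω, w₂ ω)) y₁
  single_h2 : entropy p s₂ ≤ mutualInfo p (fun ω => (Q ω, s₂ ω, x₂ ω, w₁ ω)) y₂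
  sum_a1_g2 : condEntropy p s₁ K + condEntropy p s₂ K ≤
    condMutualInfo p (fun ω => (s₁ ω, x₁ ω)) y₁ (fun ω => (K ω, Q ω, w₁ ω, w₂ ω)) +
    condMutualInfo p (fun ω => (w₁ ω, s₂ ω, x₂ ω)) y₂ (fun ω => (K ω, Q ω))
  sum_a2_g1 : condEntropy p s₁ K + condEntropy p s₂ K ≤
    condMutualInfo p (fun ω => (s₂ ω, x₂ ω)) y₂ (fun ω => (K ω, Q ω, w₁ ω, w₂ ω)) +
    condMutualInfo p (fun ω => (w₂ ω, s₁ ω, x₁ ω)) y₁ (fun ω => (K ω, Q ω))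
  sum_a1_h2 : condEntropy p s₁ K + entropy p s₂ ≤
    condMutualInfo p (fun ω => (s₁ ω, x₁ ω)) y₁ (fun ω => (K ω, Q ω, w₁ ω, w₂ ω)) +
    mutualInfo p (fun ω => (Q ω, s₂ ω, x₂ ω, w₁ ω)) y₂
  sum_a2_h1 : entropy p s₁ + condEntropy p s₂ K ≤
    condMutualInfo p (fun ω => (s₂ ω, x₂ ω)) y₂ (fun ω => (K ω, Q ω, w₁ ω, w₂ ω)) +
    mutualInfo p (fun ω => (Q ω, s₁ ω, x₁ ω, w₂ ω)) y₁
  sum_e1_e2 : condEntropy p s₁ K + condEntropy p s₂ K ≤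
    condMutualInfo p (fun ω => (w₂ ω, s₁ ω, x₁ ω)) y₁ (fun ω => (K ω, Q ω, w₁ ω)) +
    condMutualInfo p (fun ω => (w₁ ω, s₂ ω, x₂ ω)) y₂ (fun ω => (K ω, Q ω, w₂ ω))
  sum_a1_g1_e2 : 2 * condEntropy p s₁ K + condEntropy p s₂ K ≤
    condMutualInfo p (fun ω => (s₁ ω, x₁ ω)) y₁ (fun ω => (K ω, Q ω, w₁ ω, w₂ ω)) +
    condMutualInfo p (fun ω => (w₂ ω, s₁ ω, x₁ ω)) y₁ (fun ω => (K ω, Q ω)) +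
    condMutualInfo p (fun ω => (w₁ ω, s₂ ω, x₂ ω)) y₂ (fun ω => (K ω, Q ω, w₂ ω))
  sum_a2_g2_e1 : condEntropy p s₁ K + 2 * condEntropy p s₂ K ≤
    condMutualInfo p (fun ω => (s₂ ω, x₂ ω)) y₂ (fun ω => (K ω, Q ω, w₁ ω, w₂ ω)) +
    condMutualInfo p (fun ω => (w₁ ω, s₂ ω, x₂ ω)) y₂ (fun ω => (K ω, Q ω)) +
    condMutualInfo p (fun ω => (w₂ ω, s₁ ω, x₁ ω)) y₁ (fun ω => (K ω, Q ω, w₁ ω))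
  sum_a1_h1_e2 : entropy p s₁ + condEntropy p s₁ K + condEntropy p s₂ K ≤
    condMutualInfo p (fun ω => (s₁ ω, x₁ ω)) y₁ (fun ω => (K ω, Q ω, w₁ ω, w₂ ω)) +
    mutualInfo p (fun ω => (Q ω, s₁ ω, x₁ ω, w₂ ω)) y₁ +
    condMutualInfo p (fun ω => (w₁ ω, s₂ ω, x₂ ω)) y₂ (fun ω => (K ω, Q ω, w₂ ω))
  sum_a2_h2_e1 : condEntropy p s₁ K + entropy p s₂ + condEntropy p s₂ K ≤
    condMutualInfo p (fun ω => (s₂ ω, x₂ ω)) y₂ (fun ω => (K ω, Q ω, w₁ ω, w₂ ω)) +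
    mutualInfo p (fun ω => (Q ω, s₂ ω, x₂ ω, w₁ ω)) y₂ +
    condMutualInfo p (fun ω => (w₂ ω, s₁ ω, x₁ ω)) y₁ (fun ω => (K ω, Q ω, w₁ ω))

/-- The joint law `P(s₁,s₂) p(q) p(w₁|q) p(w₂|q) p(x₁|s₁,w₁,q) p(x₂|s₂,w₂,q) W(y₁,y₂|x₁,x₂)` of
an outcome `(s₁, s₂, q, w₁, w₂, x₁, x₂, y₁, y₂)`. -/
def lcJoint {S₁ S₂ θ W₁ W₂ X₁ X₂ Y₁ Y₂ : Type*} (P : S₁ × S₂ → ℝ) (W : X₁ × X₂ → Y₁ × Y₂ → ℝ)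
    (pQ : θ → ℝ) (pW₁ : θ → W₁ → ℝ) (pW₂ : θ → W₂ → ℝ)
    (pX₁ : S₁ × W₁ × θ → X₁ → ℝ) (pX₂ : S₂ × W₂ × θ → X₂ → ℝ) :
    S₁ × S₂ × θ × W₁ × W₂ × X₁ × X₂ × Y₁ × Y₂ → ℝ :=
  fun (s₁, s₂, q, w₁, w₂, x₁, x₂, y₁, y₂) =>
    P (s₁, s₂) * pQ q * pW₁ q w₁ * pW₂ q w₂ * pX₁ (s₁, w₁, q) x₁ * pX₂ (s₂, w₂, q) x₂ *
      W (x₁, x₂) (y₁, y₂)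

/-- The Liu–Chen sufficient conditions for transmissibility of the source pair with law `P` over
the interference channel `W`: the inequalities hold for some finite auxiliary alphabets and some
test distribution of the form `lcJoint`. -/
def LCConditions {S₁ S₂ X₁ X₂ Y₁ Y₂ : Type*}
    [Fintype S₁] [Fintype S₂] [Fintype X₁] [Fintype X₂] [Fintype Y₁] [Fintype Y₂]
    (P : S₁ × S₂ → ℝ) (W : X₁ × X₂ → Y₁ × Y₂ → ℝ) : Prop :=
  ∃ (nK nQ nW₁ nW₂ : ℕ) (f : S₁ → Fin nK) (g : S₂ → Fin nK)
    (pQ : Fin nQ → ℝ) (pW₁ : Fin nQ → Fin nW₁ → ℝ) (pW₂ : Fin nQ → Fin nW₂ → ℝ)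
    (pX₁ : S₁ × Fin nW₁ × Fin nQ → X₁ → ℝ) (pX₂ : S₂ × Fin nW₂ × Fin nQ → X₂ → ℝ),
    IsCommonPart P f g ∧ pQ ∈ stdSimplex ℝ (Fin nQ) ∧ IsChannel pW₁ ∧ IsChannel pW₂ ∧
    IsChannel pX₁ ∧ IsChannel pX₂ ∧
    LCInequalities (lcJoint P W pQ pW₁ pW₂ pX₁ pX₂)
      (fun ω => ω.1) (fun ω => ω.2.1) (fun ω => f ω.1) (fun ω => ω.2.2.1) (fun ω => ω.2.2.2.1)
      (fun ω => ω.2.2.2.2.1) (fun ω => ω.2.2.2.2.2.1) (fun ω => ω.2.2.2.2.2.2.1)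
      (fun ω => ω.2.2.2.2.2.2.2.1) (fun ω => ω.2.2.2.2.2.2.2.2)

/-! ### The modified Dueck example -/

/-- The source law of the example on pairs `(c, d)` of words in `{0, …, a-1}^k`. -/
def dueckSource (η a k : ℕ) : (Fin k → Fin a) × (Fin k → Fin a) → ℝ :=
  fun (c, d) =>
    if c = d then
      if ∀ i, (c i : ℕ) = 0 then ((k : ℝ) - 1) / k
      else ((a : ℝ) ^ (η * k) - 1) / (k * (a : ℝ) ^ (η * k) * ((a : ℝ) ^ k - 1))
    else if ∀ i, (c i : ℕ) = 0 then 1 / (k * (a : ℝ) ^ (η * k) * ((a : ℝ) ^ k - 1))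
    else 0

/-- The shared channel: the output is the common input if both inputs agree, and `0` otherwise. -/
def sharedChannel (a : ℕ) : Fin a × Fin a → Fin a → ℝ :=
  fun (u₁, u₂) y =>
    if u₁ = u₂ then (if y = u₁ then 1 else 0) else (if (y : ℕ) = 0 then 1 else 0)

/-- The interference channel of the example: both receivers see the same output of the shared
channel, and receiver `j` sees the output of the satellite channel `Vⱼ`. -/
def dueckChannel (a : ℕ) {X₁ X₂ Y₁ Y₂ : Type*} (V₁ : X₁ → Y₁ → ℝ) (V₂ : X₂ → Y₂ → ℝ) :
    (Fin a × X₁) × (Fin a × X₂) → (Fin a × Y₁) × (Fin a × Y₂) → ℝ :=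
  fun ((u₁, x₁), (u₂, x₂)) ((y₀, y₁), (y₀', y₂)) =>
    if y₀ = y₀' then V₁ x₁ y₁ * V₂ x₂ y₂ * sharedChannel a (u₁, u₂) y₀ else 0

end

open scoped Classical in
/-- The law of the random variable `A` when outcomes are drawn from `p`. -/
noncomputable def marg {Ω α : Type*} [Fintype Ω] (p : Ω → ℝ) (A : Ω → α) (a : α) : ℝ :=
  ∑ ω with A ω = a, p ω

section Entropy

variable {Ω α β γ : Type*} [Fintype Ω] {p : Ω → ℝ}

lemma marg_nonneg (hp : ∀ ω, 0 ≤ p ω) (A : Ω → α) (a : α) : 0 ≤ marg p A a :=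
  Finset.sum_nonneg fun ω _ => hp ω

lemma le_marg (hp : ∀ ω, 0 ≤ p ω) (A : Ω → α) (ω : Ω) : p ω ≤ marg p A (A ω) := by
  classical
  exact Finset.single_le_sum (f := p) (fun ω _ => hp ω) (by simp)

lemma marg_le_marg (hp : ∀ ω, 0 ≤ p ω) (A : Ω → α) (B : Ω → β) (a : α) (b : β)
    (h : ∀ ω, A ω = a → B ω = b) : marg p A a ≤ marg p B b := by
  classical
  refine Finset.sum_le_sum_of_subset_of_nonneg (fun ω hω => ?_) fun ω _ _ => hp ω
  simp only [Finset.mem_filter, Finset.mem_univ, true_and] at hω ⊢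
  exact h ω hω

lemma marg_congr (p : Ω → ℝ) (A : Ω → α) (B : Ω → β) (a : α) (b : β)
    (h : ∀ ω, A ω = a ↔ B ω = b) : marg p A a = marg p B b := by
  classical
  refine Finset.sum_congr (Finset.ext fun ω => ?_) fun _ _ => rfl
  simp [h]

lemma marg_eq_sum (p : Ω → ℝ) {A : Ω → α} {a : α} (h : ∀ ω, A ω = a) :
    marg p A a = ∑ ω, p ω := by
  simp [marg, h]

variable [Fintype α] [Fintype β] [Fintype γ]

lemma sum_mul_comp (p : Ω → ℝ) (A : Ω → α) (F : α → ℝ) :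
    ∑ ω, p ω * F (A ω) = ∑ a, marg p A a * F a := by
  classical
  rw [← Finset.sum_fiberwise Finset.univ A]
  refine Finset.sum_congr rfl fun a _ => ?_
  rw [marg, Finset.sum_mul]
  exact Finset.sum_congr (by congr) fun ω hω => by
    rw [(Finset.mem_filter.1 hω).2]

lemma sum_marg (p : Ω → ℝ) (A : Ω → α) : ∑ a, marg p A a = ∑ ω, p ω := by
  simpa using (sum_mul_comp p A fun _ => 1).symm

lemma entropy_eq_sum (p : Ω → ℝ) (A : Ω → α) :
    entropy p A = ∑ ω, p ω * -Real.log (marg p A (A ω)) := by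
  rw [sum_mul_comp p A fun a => -Real.log (marg p A a)]
  simp [entropy, Real.negMulLog, marg]

/-- Gibbs' inequality for conditional entropy. -/
lemma condEntropy_le (hp : ∀ ω, 0 ≤ p ω) (B : Ω → β) (C : Ω → γ) (r : β → γ → ℝ)
    (hr : ∀ b c, 0 ≤ r b c) (hpos : ∀ ω, 0 < p ω → 0 < r (B ω) (C ω))
    (hsum : ∀ c, ∑ b, r b c ≤ 1) :
    condEntropy p B C ≤ ∑ ω, p ω * -Real.log (r (B ω) (C ω)) := by
  set M := marg p fun ω => (B ω, C ω) with hM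
  have hMn : ∀ x, 0 ≤ M x := marg_nonneg hp _
  have key : ∑ ω, p ω * (marg p C (C ω) * r (B ω) (C ω) / M (B ω, C ω)) ≤ ∑ ω, p ω := by
    rw [sum_mul_comp p (fun ω => (B ω, C ω)) fun x => marg p C x.2 * r x.1 x.2 / M x,
      ← sum_marg p C]
    calc ∑ x, M x * (marg p C x.2 * r x.1 x.2 / M x)
        ≤ ∑ x : β × γ, marg p C x.2 * r x.1 x.2 := by
          refine Finset.sum_le_sum fun x _ => ?_
          rcases (hMn x).eq_or_lt with h | h
          · rw [← h, zero_mul]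
            exact mul_nonneg (marg_nonneg hp _ _) (hr _ _)
          · rw [mul_div_cancel₀ _ h.ne']
      _ = ∑ c, marg p C c * ∑ b, r b c := by
          rw [Fintype.sum_prod_type_right]
          simp [Finset.mul_sum]
      _ ≤ ∑ c, marg p C c := Finset.sum_le_sum fun c _ =>
          mul_le_of_le_one_right (marg_nonneg hp _ _) (hsum c)
  rw [condEntropy, entropy_eq_sum, entropy_eq_sum, ← Finset.sum_sub_distrib, ← sub_nonpos,
    ← Finset.sum_sub_distrib]
  refine le_trans (Finset.sum_le_sum fun ω _ => ?_) (sub_nonpos.2 key |> le_trans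
    (Finset.sum_sub_distrib (s := Finset.univ)
      (f := fun ω => p ω * (marg p C (C ω) * r (B ω) (C ω) / M (B ω, C ω))) (g := p)).le)
  rcases (hp ω).eq_or_lt with h | h
  · simp [← h]
  · have h1 : 0 < M (B ω, C ω) := h.trans_le (le_marg hp _ ω)
    have h2 : 0 < marg p C (C ω) := h.trans_le (le_marg hp C ω)
    have h3 := hpos ω h
    have h4 := Real.log_le_sub_one_of_pos (div_pos (mul_pos h2 h3) h1)
    rw [Real.log_div (mul_pos h2 h3).ne' h1.ne', Real.log_mul h2.ne' h3.ne'] at h4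
    have := mul_le_mul_of_nonneg_left h4 h.le
    rw [← hM]
    linarith

/-- An upper bound on `I(A ; B | C)` from a pointwise bound `v` on the conditional law of `B` given
`(A, C)` and an arbitrary conditional law `r` of `B` given `C`. -/
lemma condMutualInfo_le (hp : ∀ ω, 0 ≤ p ω) (A : Ω → α) (B : Ω → β) (C : Ω → γ) (v : Ω → ℝ)
    (hv : ∀ ω, marg p (fun ω => (A ω, B ω, C ω)) (A ω, B ω, C ω) ≤
      marg p (fun ω => (A ω, C ω)) (A ω, C ω) * v ω) (r : β → γ → ℝ)
    (hr : ∀ b c, 0 ≤ r b c) (hpos : ∀ ω, 0 < p ω → 0 < r (B ω) (C ω))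
    (hsum : ∀ c, ∑ b, r b c ≤ 1) :
    condMutualInfo p A B C ≤ ∑ ω, p ω * (Real.log (v ω) - Real.log (r (B ω) (C ω))) := by
  have h1 := condEntropy_le hp B C r hr hpos hsum
  have h2 : entropy p (fun ω => (A ω, C ω)) - entropy p (fun ω => (A ω, B ω, C ω)) ≤
      ∑ ω, p ω * Real.log (v ω) := by
    rw [entropy_eq_sum, entropy_eq_sum, ← Finset.sum_sub_distrib]
    refine Finset.sum_le_sum fun ω _ => ?_
    rcases (hp ω).eq_or_lt with h | h
    · simp [← h]
    · have h3 := h.trans_le (le_marg hp (fun ω => (A ω, B ω, C ω)) ω)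
      have h4 := h.trans_le (le_marg hp (fun ω => (A ω, C ω)) ω)
      have h5 : 0 < v ω := pos_of_mul_pos_right (h3.trans_le (hv ω)) h4.le
      have h6 := Real.log_le_log h3 (hv ω)
      rw [Real.log_mul h4.ne' h5.ne'] at h6
      nlinarith
  simp only [mul_sub, Finset.sum_sub_distrib]
  simp only [mul_neg, Finset.sum_neg_distrib] at h1
  simp only [condMutualInfo, condEntropy] at h1 ⊢
  linarith

end Entropy

section Capacity

variable {X Y : Type*} [Fintype X] [Fintype Y] {V : X → Y → ℝ}

lemma marg_fst_joint (hV : IsChannel V) (q : X → ℝ) (x : X) :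
    marg (fun z : X × Y => q z.1 * V z.1 z.2) Prod.fst x = q x := by
  classical
  rw [marg, Finset.sum_filter, Fintype.sum_prod_type]
  simp only
  rw [Finset.sum_eq_single x (by intro b _ hb; simp [hb]) (by simp)]
  simp [← Finset.mul_sum, (hV x).2]

lemma marg_snd_joint (q : X → ℝ) (y : Y) :
    marg (fun z : X × Y => q z.1 * V z.1 z.2) Prod.snd y = ∑ x, q x * V x y := by
  classical
  rw [marg, Finset.sum_filter, Fintype.sum_prod_type]
  refine Finset.sum_congr rfl fun x _ => ?_
  simp

/-- Mutual information between the input and the output of a channel as an expected log-likelihood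
ratio. -/
lemma mutualInfo_channel (hV : IsChannel V) {q : X → ℝ} (hq : ∀ x, 0 ≤ q x) :
    mutualInfo (fun z : X × Y => q z.1 * V z.1 z.2) Prod.fst Prod.snd =
      ∑ x, ∑ y, q x * V x y * (Real.log (V x y) - Real.log (∑ x', q x' * V x' y)) := by
  rw [mutualInfo, condEntropy, entropy_eq_sum, entropy_eq_sum, entropy_eq_sum,
    ← Finset.sum_sub_distrib, ← Finset.sum_sub_distrib, Fintype.sum_prod_type]
  refine Finset.sum_congr rfl fun x _ => Finset.sum_congr rfl fun y _ => ?_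
  simp only [marg_fst_joint hV, marg_snd_joint]
  have : marg (fun z : X × Y => q z.1 * V z.1 z.2) (fun ω => (ω.1, ω.2)) (x, y) = q x * V x y := by
    classical
    rw [marg]
    simp [Finset.filter_eq']
  rw [this]
  rcases (mul_nonneg (hq x) ((hV x).1 y)).eq_or_lt with h | h
  · simp [← h]
  · have h1 : q x ≠ 0 := left_ne_zero_of_mul h.ne'
    have h2 : V x y ≠ 0 := right_ne_zero_of_mul h.ne'
    rw [Real.log_mul h1 h2]
    ring

lemma entropy_nonneg {Ω α : Type*} [Fintype Ω] [Fintype α] {p : Ω → ℝ} (hp : ∀ ω, 0 ≤ p ω)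
    (hp1 : ∑ ω, p ω = 1) (A : Ω → α) : 0 ≤ entropy p A := by
  classical
  refine Finset.sum_nonneg fun a _ => Real.negMulLog_nonneg (Finset.sum_nonneg fun ω _ => hp ω) ?_
  rw [← hp1]
  exact Finset.sum_le_sum_of_subset_of_nonneg (Finset.subset_univ _) fun ω _ _ => hp ω

lemma entropy_le_log_card {Ω α : Type*} [Fintype Ω] [Fintype α] [Nonempty α] {p : Ω → ℝ}
    (hp : ∀ ω, 0 ≤ p ω) (hp1 : ∑ ω, p ω = 1) (A : Ω → α) :
    entropy p A ≤ Real.log (Fintype.card α) := by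
  have h := condEntropy_le hp A (fun _ => ()) (fun _ _ => (Fintype.card α : ℝ)⁻¹)
    (fun _ _ => by positivity) (fun _ _ => by positivity) (fun _ => by simp)
  have h1 : entropy p (fun _ : Ω => ()) = 0 := by
    simp [entropy, hp1]
  have h2 : entropy p (fun ω => (A ω, ())) = entropy p A := by
    rw [entropy_eq_sum, entropy_eq_sum]
    refine Finset.sum_congr rfl fun ω _ => ?_
    rw [marg_congr p (fun ω => (A ω, ())) A _ (A ω) fun ω' => by simp]
  rw [condEntropy, h1, h2, ← Finset.sum_mul, hp1] at h
  simpa using h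

lemma mutualInfo_le_capacity (hV : IsChannel V) {q : X → ℝ} (hq : q ∈ stdSimplex ℝ X) :
    mutualInfo (fun z : X × Y => q z.1 * V z.1 z.2) Prod.fst Prod.snd ≤ capacity V := by
  have hbdd : BddAbove (Set.range fun p : stdSimplex ℝ X =>
      mutualInfo (fun z : X × Y => (p : X → ℝ) z.1 * V z.1 z.2) Prod.fst Prod.snd) := by
    refine ⟨Real.log (Fintype.card X) + Real.log (Fintype.card Y), ?_⟩
    rintro _ ⟨⟨p, hp⟩, rfl⟩
    have h0 : ∀ z : X × Y, 0 ≤ p z.1 * V z.1 z.2 := fun z => mul_nonneg (hp.1 _) ((hV _).1 _)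
    have h1 : ∑ z : X × Y, p z.1 * V z.1 z.2 = 1 := by
      simp [Fintype.sum_prod_type, ← Finset.mul_sum, (hV _).2, hp.2]
    have : Nonempty (X × Y) := by
      by_contra h
      rw [not_nonempty_iff] at h
      simp at h1
    have : Nonempty X := this.map Prod.fst
    have : Nonempty Y := ‹Nonempty (X × Y)›.map Prod.snd
    have h2 := entropy_le_log_card h0 h1 (Prod.fst : X × Y → X)
    have h3 := entropy_le_log_card h0 h1 (Prod.snd : X × Y → Y)
    have h4 := entropy_nonneg h0 h1 (fun ω : X × Y => (ω.1, ω.2))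
    change entropy (fun z : X × Y => p z.1 * V z.1 z.2) Prod.fst -
      (entropy (fun z : X × Y => p z.1 * V z.1 z.2) (fun ω => (ω.1, ω.2)) -
        entropy (fun z : X × Y => p z.1 * V z.1 z.2) Prod.snd) ≤ _
    linarith
  exact le_ciSup hbdd ⟨q, hq⟩

end Capacity

/-- The output letter of the shared channel. -/
def sharedOut {a : ℕ} (u₁ u₂ : Fin a) : Fin a :=
  if u₁ = u₂ then u₁ else ⟨0, u₁.pos⟩

lemma sharedChannel_eq {a : ℕ} (u₁ u₂ y : Fin a) :
    sharedChannel a (u₁, u₂) y = if y = sharedOut u₁ u₂ then 1 else 0 := by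
  simp only [sharedChannel, sharedOut, Fin.ext_iff]
  split_ifs <;> simp_all

section Dueck

variable {a : ℕ} {X₁ X₂ Y₁ Y₂ : Type*} {V₁ : X₁ → Y₁ → ℝ} {V₂ : X₂ → Y₂ → ℝ}

lemma sum_dueckChannel_right [Fintype Y₂] (hV₂ : IsChannel V₂) (x₁ : Fin a × X₁) (x₂ : Fin a × X₂)
    (y₁ : Fin a × Y₁) :
    ∑ y₂, dueckChannel a V₁ V₂ (x₁, x₂) (y₁, y₂) =
      V₁ x₁.2 y₁.2 * if y₁.1 = sharedOut x₁.1 x₂.1 then 1 else 0 := by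
  rw [Fintype.sum_prod_type]
  simp only [dueckChannel, Finset.sum_ite_irrel, Finset.sum_const_zero]
  rw [Finset.sum_ite_eq Finset.univ y₁.1]
  simp only [Finset.mem_univ, if_true, ← Finset.sum_mul, ← Finset.mul_sum, (hV₂ _).2, mul_one,
    sharedChannel_eq]

lemma sum_dueckChannel_left [Fintype Y₁] (hV₁ : IsChannel V₁) (x₁ : Fin a × X₁) (x₂ : Fin a × X₂)
    (y₂ : Fin a × Y₂) :
    ∑ y₁, dueckChannel a V₁ V₂ (x₁, x₂) (y₁, y₂) =
      V₂ x₂.2 y₂.2 * if y₂.1 = sharedOut x₁.1 x₂.1 then 1 else 0 := by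
  rw [Fintype.sum_prod_type]
  simp only [dueckChannel, Finset.sum_ite_irrel, Finset.sum_const_zero]
  rw [Finset.sum_ite_eq' Finset.univ y₂.1]
  simp only [Finset.mem_univ, if_true, ← Finset.sum_mul, (hV₁ _).2, one_mul,
    sharedChannel_eq]

variable [Fintype Y₁] [Fintype Y₂]

lemma isChannel_dueckChannel (hV₁ : IsChannel V₁) (hV₂ : IsChannel V₂) :
    IsChannel (dueckChannel a V₁ V₂) := by
  rintro ⟨x₁, x₂⟩
  refine ⟨fun ⟨y₁, y₂⟩ => ?_, ?_⟩
  · simp only [dueckChannel, sharedChannel_eq]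
    have := (hV₁ x₁.2).1 y₁.2
    have := (hV₂ x₂.2).1 y₂.2
    split_ifs <;> positivity
  · rw [Fintype.sum_prod_type]
    simp only [sum_dueckChannel_right hV₂]
    rw [Fintype.sum_prod_type]
    simp [(hV₁ _).2]

variable [Fintype X₁] [Fintype X₂]
  {S₁ S₂ θ W₁ W₂ : Type*} [Fintype S₁] [Fintype S₂] [Fintype θ] [Fintype W₁] [Fintype W₂]
  {P : S₁ × S₂ → ℝ} {pQ : θ → ℝ} {pW₁ : θ → W₁ → ℝ} {pW₂ : θ → W₂ → ℝ}
  {pX₁ : S₁ × W₁ × θ → Fin a × X₁ → ℝ} {pX₂ : S₂ × W₂ × θ → Fin a × X₂ → ℝ}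

/-- The joint law of the sources, the auxiliary variables and the channel inputs. -/
def lcInput {S₁ S₂ θ W₁ W₂ X₁ X₂ : Type*} (P : S₁ × S₂ → ℝ)
    (pQ : θ → ℝ) (pW₁ : θ → W₁ → ℝ) (pW₂ : θ → W₂ → ℝ)
    (pX₁ : S₁ × W₁ × θ → X₁ → ℝ) (pX₂ : S₂ × W₂ × θ → X₂ → ℝ) :
    S₁ × S₂ × θ × W₁ × W₂ × X₁ × X₂ → ℝ :=
  fun (s₁, s₂, q, w₁, w₂, x₁, x₂) =>
    P (s₁, s₂) * pQ q * pW₁ q w₁ * pW₂ q w₂ * pX₁ (s₁, w₁, q) x₁ * pX₂ (s₂, w₂, q) x₂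

/-- The coordinates of an outcome that precede the channel outputs. -/
def inputPart {S₁ S₂ θ W₁ W₂ X₁ X₂ Y₁ Y₂ : Type*} :
    S₁ × S₂ × θ × W₁ × W₂ × X₁ × X₂ × Y₁ × Y₂ → S₁ × S₂ × θ × W₁ × W₂ × X₁ × X₂ :=
  fun (s₁, s₂, q, w₁, w₂, x₁, x₂, _, _) => (s₁, s₂, q, w₁, w₂, x₁, x₂)

lemma sum_lcJoint (hV₂ : IsChannel V₂)
    (F : S₁ × S₂ × θ × W₁ × W₂ × (Fin a × X₁) × (Fin a × X₂) → Fin a × Y₁ → ℝ) :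
    ∑ ω, lcJoint P (dueckChannel a V₁ V₂) pQ pW₁ pW₂ pX₁ pX₂ ω *
        F (inputPart ω) ω.2.2.2.2.2.2.2.1 =
      ∑ z, lcInput P pQ pW₁ pW₂ pX₁ pX₂ z *
        ∑ y, V₁ z.2.2.2.2.2.1.2 y * F z (sharedOut z.2.2.2.2.2.1.1 z.2.2.2.2.2.2.1, y) := by
  have hsum : ∀ (x₁ : Fin a × X₁) (x₂ : Fin a × X₂) (G : Fin a × Y₁ → ℝ) (c : ℝ),
      ∑ y₁, ∑ y₂, c * dueckChannel a V₁ V₂ (x₁, x₂) (y₁, y₂) * G y₁ =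
        c * ∑ y, V₁ x₁.2 y * G (sharedOut x₁.1 x₂.1, y) := by
    intro x₁ x₂ G c
    simp only [← Finset.sum_mul, ← Finset.mul_sum, sum_dueckChannel_right hV₂]
    rw [Fintype.sum_prod_type_right, Finset.mul_sum]
    refine Finset.sum_congr rfl fun y _ => ?_
    rw [Finset.sum_eq_single (sharedOut x₁.1 x₂.1) (by intro b _ hb; simp [hb]) (by simp)]
    simp [mul_assoc]
  simp only [Fintype.sum_prod_type (γ := ℝ) (α₁ := S₁), Fintype.sum_prod_type (γ := ℝ) (α₁ := S₂),
    Fintype.sum_prod_type (γ := ℝ) (α₁ := θ), Fintype.sum_prod_type (γ := ℝ) (α₁ := W₁),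
    Fintype.sum_prod_type (γ := ℝ) (α₁ := W₂), Fintype.sum_prod_type (γ := ℝ) (α₁ := Fin a × X₁),
    Fintype.sum_prod_type (γ := ℝ) (α₁ := Fin a × X₂),
    Fintype.sum_prod_type (γ := ℝ) (α₁ := Fin a × Y₁), lcJoint, inputPart, hsum, lcInput]

lemma lcInput_nonneg
    (hP : P ∈ stdSimplex ℝ (S₁ × S₂)) (hQ : pQ ∈ stdSimplex ℝ θ) (hW₁ : IsChannel pW₁)
    (hW₂ : IsChannel pW₂) (hX₁ : IsChannel pX₁) (hX₂ : IsChannel pX₂) (z) : 0 ≤ lcInput P pQ pW₁ pW₂ pX₁ pX₂ z := by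
  obtain ⟨s₁, s₂, q, w₁, w₂, x₁, x₂⟩ := z
  have := hP.1 (s₁, s₂)
  have := hQ.1 q
  have := (hW₁ q).1 w₁
  have := (hW₂ q).1 w₂
  have := (hX₁ (s₁, w₁, q)).1 x₁
  have := (hX₂ (s₂, w₂, q)).1 x₂
  simp only [lcInput]
  positivity

lemma lcJoint_nonneg
    (hP : P ∈ stdSimplex ℝ (S₁ × S₂)) (hQ : pQ ∈ stdSimplex ℝ θ) (hW₁ : IsChannel pW₁)
    (hW₂ : IsChannel pW₂) (hX₁ : IsChannel pX₁) (hX₂ : IsChannel pX₂) (hV₁ : IsChannel V₁)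
    (hV₂ : IsChannel V₂) (ω) : 0 ≤ lcJoint P (dueckChannel a V₁ V₂) pQ pW₁ pW₂ pX₁ pX₂ ω := by
  obtain ⟨s₁, s₂, q, w₁, w₂, x₁, x₂, y₁, y₂⟩ := ω
  exact mul_nonneg (lcInput_nonneg hP hQ hW₁ hW₂ hX₁ hX₂ (s₁, s₂, q, w₁, w₂, x₁, x₂))
    ((isChannel_dueckChannel hV₁ hV₂ (x₁, x₂)).1 (y₁, y₂))

lemma sum_lcInput
    (hQ : pQ ∈ stdSimplex ℝ θ) (hW₁ : IsChannel pW₁) (hW₂ : IsChannel pW₂) (hX₁ : IsChannel pX₁)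
    (hX₂ : IsChannel pX₂) (F : S₁ × S₂ → ℝ) :
    ∑ z, lcInput P pQ pW₁ pW₂ pX₁ pX₂ z * F (z.1, z.2.1) = ∑ s, P s * F s := by
  simp only [Fintype.sum_prod_type (γ := ℝ) (α₁ := S₁), Fintype.sum_prod_type (γ := ℝ) (α₁ := S₂),
    Fintype.sum_prod_type (γ := ℝ) (α₁ := θ), Fintype.sum_prod_type (γ := ℝ) (α₁ := W₁),
    Fintype.sum_prod_type (γ := ℝ) (α₁ := W₂), Fintype.sum_prod_type (γ := ℝ) (α₁ := Fin a × X₁),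
    lcInput]
  simp only [← Finset.sum_mul, ← Finset.mul_sum, (hX₂ _).2, (hX₁ _).2, (hW₁ _).2, (hW₂ _).2, hQ.2,
    mul_one]

lemma sum_lcJoint_source
    (hQ : pQ ∈ stdSimplex ℝ θ) (hW₁ : IsChannel pW₁) (hW₂ : IsChannel pW₂) (hX₁ : IsChannel pX₁)
    (hX₂ : IsChannel pX₂) (hV₁ : IsChannel V₁) (hV₂ : IsChannel V₂) (F : S₁ × S₂ → ℝ) :
    ∑ ω, lcJoint P (dueckChannel a V₁ V₂) pQ pW₁ pW₂ pX₁ pX₂ ω * F (ω.1, ω.2.1) =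
      ∑ s, P s * F s := by
  refine (sum_lcJoint hV₂ fun z _ => F (z.1, z.2.1)).trans ?_
  simp only [← Finset.sum_mul, (hV₁ _).2, one_mul]
  exact sum_lcInput hQ hW₁ hW₂ hX₁ hX₂ F

/-- The satellite output depends on what precedes it only through the satellite input. -/
lemma marg_satellite
    (hV₁ : IsChannel V₁) (hV₂ : IsChannel V₂) {δ : Type*}
    (D : S₁ × S₂ × θ × W₁ × W₂ × (Fin a × X₁) × (Fin a × X₂) → δ) (x : δ → X₁)
    (hx : ∀ z, x (D z) = z.2.2.2.2.2.1.2) (d : δ) (y : Y₁) :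
    marg (lcJoint P (dueckChannel a V₁ V₂) pQ pW₁ pW₂ pX₁ pX₂)
        (fun ω => (D (inputPart ω), ω.2.2.2.2.2.2.2.1.2)) (d, y) =
      marg (lcJoint P (dueckChannel a V₁ V₂) pQ pW₁ pW₂ pX₁ pX₂)
        (fun ω => D (inputPart ω)) d * V₁ (x d) y := by
  classical
  have h1 := sum_lcJoint (P := P) (pQ := pQ) (pW₁ := pW₁) (pW₂ := pW₂) (pX₁ := pX₁) (pX₂ := pX₂)
    (V₁ := V₁) hV₂ fun z y' => if (D z, y'.2) = (d, y) then 1 else 0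
  have h2 := sum_lcJoint (P := P) (pQ := pQ) (pW₁ := pW₁) (pW₂ := pW₂) (pX₁ := pX₁) (pX₂ := pX₂)
    (V₁ := V₁) hV₂ fun z _ => if D z = d then 1 else 0
  simp only [← Finset.sum_mul, (hV₁ _).2, one_mul] at h2
  simp only [mul_ite, mul_one, mul_zero] at h1 h2
  simp only [marg, Finset.sum_filter]
  rw [h1, h2, Finset.sum_mul]
  refine Finset.sum_congr rfl fun z _ => ?_
  by_cases h : D z = d
  · subst h
    simp [hx]
  · simp [h]

end Dueck

/-- A guess for the law of the output of the shared channel, when the input of the second user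
follows the law of the first coordinate of `β`. -/
noncomputable def sharedGuess {a : ℕ} {X : Type*} [Fintype X] (β : Fin a × X → ℝ) (y : Fin a) : ℝ :=
  ((if (y : ℕ) = 0 then 1 else 0) + (a : ℝ)⁻¹ + ∑ x, β (y, x)) / 3

section SharedGuess

variable {a : ℕ} {X₁ X₂ : Type*} [Fintype X₁] [Fintype X₂]
  {α : Fin a × X₁ → ℝ} {β : Fin a × X₂ → ℝ}

lemma inv_le_sharedGuess (hβ : ∀ z, 0 ≤ β z) (y : Fin a) : (3 * a : ℝ)⁻¹ ≤ sharedGuess β y := by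
  have h1 : 0 ≤ ∑ x, β (y, x) := Finset.sum_nonneg fun x _ => hβ _
  have h2 : (0 : ℝ) ≤ if (y : ℕ) = 0 then 1 else 0 := by split_ifs <;> norm_num
  rw [sharedGuess, mul_inv]
  linarith

lemma sharedGuess_pos (hβ : ∀ z, 0 ≤ β z) (y : Fin a) : 0 < sharedGuess β y := by
  have : (0 : ℝ) < a := by exact_mod_cast y.pos
  exact lt_of_lt_of_le (by positivity) (inv_le_sharedGuess hβ y)

lemma neg_log_sharedGuess_le (hβ : ∀ z, 0 ≤ β z) (y : Fin a) :
    -Real.log (sharedGuess β y) ≤ Real.log 3 + Real.log a := by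
  have : (0 : ℝ) < a := by exact_mod_cast y.pos
  have h := Real.log_le_log (by positivity) (inv_le_sharedGuess hβ y)
  rw [Real.log_inv, Real.log_mul (by norm_num) this.ne'] at h
  linarith

lemma sum_sharedGuess_le (hβ : β ∈ stdSimplex ℝ (Fin a × X₂)) : ∑ y, sharedGuess β y ≤ 1 := by
  have h1 : ∑ y : Fin a, (if (y : ℕ) = 0 then (1 : ℝ) else 0) ≤ 1 := by
    rw [Finset.sum_boole]
    have : (Finset.univ.filter fun y : Fin a => (y : ℕ) = 0).card ≤ 1 :=
      Finset.card_le_one.2 fun i hi j hj => by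
        simp only [Finset.mem_filter] at hi hj
        exact Fin.ext (hi.2.trans hj.2.symm)
    exact_mod_cast this
  have h2 : ∑ _y : Fin a, (a : ℝ)⁻¹ ≤ 1 := by
    simp [mul_inv_le_one]
  have h3 := hβ.2
  rw [Fintype.sum_prod_type] at h3
  simp only [sharedGuess]
  rw [← Finset.sum_div, Finset.sum_add_distrib, Finset.sum_add_distrib, h3]
  linarith

/-- Independent users convey only boundedly many nats through the shared channel. -/
lemma shared_cost_le (hα : α ∈ stdSimplex ℝ (Fin a × X₁)) (hβ : β ∈ stdSimplex ℝ (Fin a × X₂)) :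
    ∑ x₁, ∑ x₂, α x₁ * β x₂ * -Real.log (sharedGuess β (sharedOut x₁.1 x₂.1)) ≤
      Real.log 3 + 1 := by
  set v : Fin a → ℝ := fun y => ∑ x, β (y, x) with hv
  have hv0 : ∀ y, 0 ≤ v y := fun y => Finset.sum_nonneg fun x _ => hβ.1 _
  have hle : ∀ x, β x ≤ v x.1 := fun x =>
    Finset.single_le_sum (f := fun x' => β (x.1, x')) (fun _ _ => hβ.1 _) (Finset.mem_univ x.2)
  have key : ∀ (x₁ : Fin a × X₁) (x₂ : Fin a × X₂),
      β x₂ * -Real.log (sharedGuess β (sharedOut x₁.1 x₂.1)) ≤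
        β x₂ * (Real.log 3 + if x₂.1 = x₁.1 then -Real.log (v x₁.1) else 0) := by
    intro x₁ x₂
    rcases (hβ.1 x₂).eq_or_lt with h | h
    · simp [← h]
    refine mul_le_mul_of_nonneg_left ?_ h.le
    have ha : (0 : ℝ) < (a : ℝ)⁻¹ := by
      have : (0 : ℝ) < a := by exact_mod_cast x₁.1.pos
      positivity
    by_cases hx : x₂.1 = x₁.1
    · have h1 : 0 < v x₁.1 := hx ▸ h.trans_le (hle x₂)
      have h2 : v x₁.1 / 3 ≤ sharedGuess β (sharedOut x₁.1 x₂.1) := by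
        have : (0 : ℝ) ≤ if (x₁.1 : ℕ) = 0 then 1 else 0 := by split_ifs <;> norm_num
        rw [sharedOut, if_pos hx.symm, sharedGuess]
        change v x₁.1 / 3 ≤ (_ + _ + v x₁.1) / 3
        linarith
      have h3 := Real.log_le_log (by positivity) h2
      rw [Real.log_div h1.ne' (by norm_num)] at h3
      rw [if_pos hx]
      linarith
    · have h2 : (1 : ℝ) / 3 ≤ sharedGuess β (sharedOut x₁.1 x₂.1) := by
        rw [sharedOut, if_neg (Ne.symm hx), sharedGuess]
        have := hv0 ⟨0, x₁.1.pos⟩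
        simp only [hv] at this
        simp only [if_true]
        linarith
      have h3 := Real.log_le_log (by positivity) h2
      rw [Real.log_div one_ne_zero (by norm_num), Real.log_one] at h3
      rw [if_neg hx]
      linarith
  have hin : ∀ x₁, ∑ x₂, α x₁ * β x₂ * -Real.log (sharedGuess β (sharedOut x₁.1 x₂.1)) ≤
      α x₁ * (Real.log 3 + 1) := by
    intro x₁
    simp only [mul_assoc]
    rw [← Finset.mul_sum]
    refine mul_le_mul_of_nonneg_left ?_ (hα.1 x₁)
    refine (Finset.sum_le_sum fun x₂ _ => key x₁ x₂).trans ?_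
    have hsum : ∑ x₂, β x₂ * (if x₂.1 = x₁.1 then -Real.log (v x₁.1) else 0) =
        Real.negMulLog (v x₁.1) := by
      rw [Fintype.sum_prod_type, Finset.sum_eq_single x₁.1 (by intro b _ hb; simp [hb]) (by simp)]
      simp only [if_true]
      rw [← Finset.sum_mul, Real.negMulLog]
      change v x₁.1 * _ = _
      ring
    simp only [mul_add, Finset.sum_add_distrib]
    rw [hsum, ← Finset.sum_mul, hβ.2, one_mul]
    have h1 := Real.negMulLog_le_one_sub_self (hv0 x₁.1)
    have h2 := hv0 x₁.1
    linarith
  refine (Finset.sum_le_sum fun x₁ _ => hin x₁).trans ?_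
  rw [← Finset.sum_mul, hα.2, one_mul]

end SharedGuess

section Converse

variable {a : ℕ} {X₁ X₂ Y₁ Y₂ : Type*} {V₁ : X₁ → Y₁ → ℝ} {V₂ : X₂ → Y₂ → ℝ}
  [Fintype X₁] [Fintype X₂] [Fintype Y₁] [Fintype Y₂]
  {S₁ S₂ θ W₁ W₂ : Type*} [Fintype S₁] [Fintype S₂] [Fintype θ] [Fintype W₁] [Fintype W₂]
  {P : S₁ × S₂ → ℝ} {pQ : θ → ℝ} {pW₁ : θ → W₁ → ℝ} {pW₂ : θ → W₂ → ℝ}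
  {pX₁ : S₁ × W₁ × θ → Fin a × X₁ → ℝ} {pX₂ : S₂ × W₂ × θ → Fin a × X₂ → ℝ}

lemma sum_lcInput_shared_cost_le
    (hP : P ∈ stdSimplex ℝ (S₁ × S₂)) (hQ : pQ ∈ stdSimplex ℝ θ) (hW₁ : IsChannel pW₁)
    (hW₂ : IsChannel pW₂) (hX₁ : IsChannel pX₁) (hX₂ : IsChannel pX₂) (o₁ : S₁) (o₂ : S₂) :
    ∑ z, lcInput P pQ pW₁ pW₂ pX₁ pX₂ z *
        -Real.log (sharedGuess (pX₂ (o₂, z.2.2.2.2.1, z.2.2.1))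
          (sharedOut z.2.2.2.2.2.1.1 z.2.2.2.2.2.2.1)) ≤
      Real.log 3 + 1 + (1 - P (o₁, o₂)) * Real.log a := by
  classical
  have hlog : 0 ≤ Real.log a := Real.log_natCast_nonneg a
  have h3 : 0 ≤ Real.log 3 := Real.log_nonneg (by norm_num)
  set c : S₁ × S₂ → ℝ := fun s => Real.log 3 + if s = (o₁, o₂) then 1 else Real.log a with hc
  calc _ ≤ ∑ z, lcInput P pQ pW₁ pW₂ pX₁ pX₂ z * c (z.1, z.2.1) := by
        simp only [Fintype.sum_prod_type (γ := ℝ) (α₁ := S₁),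
          Fintype.sum_prod_type (γ := ℝ) (α₁ := S₂),
          Fintype.sum_prod_type (γ := ℝ) (α₁ := θ), Fintype.sum_prod_type (γ := ℝ) (α₁ := W₁),
          Fintype.sum_prod_type (γ := ℝ) (α₁ := W₂),
          Fintype.sum_prod_type (γ := ℝ) (α₁ := Fin a × X₁)]
        refine Finset.sum_le_sum fun s₁ _ => Finset.sum_le_sum fun s₂ _ =>
          Finset.sum_le_sum fun q _ => Finset.sum_le_sum fun w₁ _ => Finset.sum_le_sum fun w₂ _ => ?_
        have hm : 0 ≤ P (s₁, s₂) * pQ q * pW₁ q w₁ * pW₂ q w₂ := by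
          have := hP.1 (s₁, s₂)
          have := hQ.1 q
          have := (hW₁ q).1 w₁
          have := (hW₂ q).1 w₂
          positivity
        have hin : ∑ x₁, ∑ x₂, pX₁ (s₁, w₁, q) x₁ * pX₂ (s₂, w₂, q) x₂ *
            -Real.log (sharedGuess (pX₂ (o₂, w₂, q)) (sharedOut x₁.1 x₂.1)) ≤ c (s₁, s₂) := by
          by_cases hs : (s₁, s₂) = (o₁, o₂)
          · simp only [hc, if_pos hs]
            obtain ⟨rfl, rfl⟩ := Prod.ext_iff.1 hs
            exact shared_cost_le (hX₁ _) (hX₂ _)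
          · simp only [hc, if_neg hs]
            calc _ ≤ ∑ x₁, ∑ x₂, pX₁ (s₁, w₁, q) x₁ * pX₂ (s₂, w₂, q) x₂ *
                  (Real.log 3 + Real.log a) :=
                Finset.sum_le_sum fun x₁ _ => Finset.sum_le_sum fun x₂ _ =>
                  mul_le_mul_of_nonneg_left (neg_log_sharedGuess_le (hX₂ _).1 _)
                    (mul_nonneg ((hX₁ _).1 _) ((hX₂ _).1 _))
              _ = _ := by
                simp only [← Finset.sum_mul, ← Finset.mul_sum, (hX₁ _).2, (hX₂ _).2, one_mul]
        have h1 := mul_le_mul_of_nonneg_left hin hm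
        have h2 : ∑ x₁, ∑ x₂, pX₁ (s₁, w₁, q) x₁ * pX₂ (s₂, w₂, q) x₂ * c (s₁, s₂) =
            c (s₁, s₂) := by
          simp only [← Finset.sum_mul, ← Finset.mul_sum, (hX₁ _).2, (hX₂ _).2, one_mul]
        rw [← h2] at h1
        simp only [Finset.mul_sum] at h1
        simp only [lcInput]
        refine le_trans (le_of_eq ?_) (h1.trans (le_of_eq ?_)) <;>
        exact Finset.sum_congr rfl fun _ _ => Finset.sum_congr rfl fun _ _ => by ring
    _ = ∑ s, P s * c s := sum_lcInput hQ hW₁ hW₂ hX₁ hX₂ c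
    _ = Real.log 3 + P (o₁, o₂) + (1 - P (o₁, o₂)) * Real.log a := by
        have : ∀ s, P s * c s = P s * (Real.log 3 + Real.log a) +
            if s = (o₁, o₂) then P s * (1 - Real.log a) else 0 := by
          intro s
          simp only [hc]
          split_ifs <;> ring
        simp only [this, Finset.sum_add_distrib]
        rw [← Finset.sum_mul, hP.2, Finset.sum_ite_eq']
        simp only [Finset.mem_univ, if_true]
        ring
    _ ≤ _ := by
        have : P (o₁, o₂) ≤ 1 := by
          rw [← hP.2]
          exact Finset.single_le_sum (fun s _ => hP.1 s) (Finset.mem_univ _)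
        linarith

/-- If the sources are constant most of the time, single-letter signalling to the first receiver
gains little from the shared channel. -/
lemma condMutualInfo_lcJoint_le {κ : Type*} [Fintype κ]
    (hP : P ∈ stdSimplex ℝ (S₁ × S₂)) (hQ : pQ ∈ stdSimplex ℝ θ) (hW₁ : IsChannel pW₁)
    (hW₂ : IsChannel pW₂) (hX₁ : IsChannel pX₁) (hX₂ : IsChannel pX₂) (hV₁ : IsChannel V₁)
    (hV₂ : IsChannel V₂) (f : S₁ → κ) (o₁ : S₁) (o₂ : S₂) :
    condMutualInfo (lcJoint P (dueckChannel a V₁ V₂) pQ pW₁ pW₂ pX₁ pX₂)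
      (fun ω => (ω.1, ω.2.2.2.2.2.1)) (fun ω => ω.2.2.2.2.2.2.2.1)
      (fun ω => (f ω.1, ω.2.2.1, ω.2.2.2.2.1)) ≤
      capacity V₁ + (Real.log 3 + 1 + (1 - P (o₁, o₂)) * Real.log a) := by
  set p := lcJoint P (dueckChannel a V₁ V₂) pQ pW₁ pW₂ pX₁ pX₂ with hp
  have hp0 : ∀ ω, 0 ≤ p ω := lcJoint_nonneg hP hQ hW₁ hW₂ hX₁ hX₂ hV₁ hV₂
  have hp1 : ∑ ω, p ω = 1 := by
    have := sum_lcJoint_source (P := P) hQ hW₁ hW₂ hX₁ hX₂ hV₁ hV₂ fun _ => 1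
    simpa [hP.2] using this
  set px : X₁ → ℝ := marg p fun ω => ω.2.2.2.2.2.1.2 with hpx
  have hpx0 : ∀ x, 0 ≤ px x := marg_nonneg hp0 _
  have hpx1 : ∑ x, px x = 1 := by rw [hpx, sum_marg, hp1]
  have hxy : ∀ x y, marg p (fun ω => (ω.2.2.2.2.2.1.2, ω.2.2.2.2.2.2.2.1.2)) (x, y) =
      px x * V₁ x y := fun x y =>
    marg_satellite hV₁ hV₂ (fun z => z.2.2.2.2.2.1.2) id (fun _ => rfl) x y
  set qy : Y₁ → ℝ := fun y => ∑ x, px x * V₁ x y with hqy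
  have hqy0 : ∀ y, 0 ≤ qy y := fun y =>
    Finset.sum_nonneg fun x _ => mul_nonneg (hpx0 x) ((hV₁ x).1 y)
  have hqy1 : ∑ y, qy y = 1 := by
    rw [hqy, Finset.sum_comm]
    simp [← Finset.mul_sum, (hV₁ _).2, hpx1]
  have hqypos : ∀ ω, 0 < p ω → 0 < qy ω.2.2.2.2.2.2.2.1.2 := fun ω h => by
    refine lt_of_lt_of_le (h.trans_le (le_marg hp0
      (fun ω => (ω.2.2.2.2.2.1.2, ω.2.2.2.2.2.2.2.1.2)) ω)) ?_
    rw [hxy]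
    exact Finset.single_le_sum (f := fun x => px x * V₁ x ω.2.2.2.2.2.2.2.1.2)
      (fun x _ => mul_nonneg (hpx0 x) ((hV₁ x).1 _)) (Finset.mem_univ _)
  set r : Fin a × Y₁ → κ × θ × W₂ → ℝ := fun b c =>
    qy b.2 * sharedGuess (pX₂ (o₂, c.2.2, c.2.1)) b.1 with hr
  refine (condMutualInfo_le hp0 _ _ _
    (fun ω => V₁ ω.2.2.2.2.2.1.2 ω.2.2.2.2.2.2.2.1.2) ?_ r ?_ ?_ ?_).trans ?_
  · intro ω
    have h := marg_satellite (P := P) (pQ := pQ) (pW₁ := pW₁) (pW₂ := pW₂) (pX₁ := pX₁)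
      (pX₂ := pX₂) hV₁ hV₂ (fun z => ((z.1, z.2.2.2.2.2.1), (f z.1, z.2.2.1, z.2.2.2.2.1)))
      (fun d => d.1.2.2) (fun _ => rfl)
      ((ω.1, ω.2.2.2.2.2.1), (f ω.1, ω.2.2.1, ω.2.2.2.2.1)) ω.2.2.2.2.2.2.2.1.2
    refine le_trans (marg_le_marg hp0 _ _ _ _ ?_) h.le
    intro ω' h'
    simp only [Prod.mk.injEq] at h'
    simp only [inputPart, Prod.mk.injEq]
    simp [h']
  · exact fun b c => mul_nonneg (hqy0 _) (sharedGuess_pos (hX₂ _).1 _).le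
  · exact fun ω h => mul_pos (hqypos ω h) (sharedGuess_pos (hX₂ _).1 _)
  · intro c
    rw [Fintype.sum_prod_type]
    simp only [hr, ← Finset.sum_mul, hqy1, one_mul]
    exact sum_sharedGuess_le (hX₂ _)
  · have hsplit : ∀ ω, p ω * (Real.log (V₁ ω.2.2.2.2.2.1.2 ω.2.2.2.2.2.2.2.1.2) -
        Real.log (r ω.2.2.2.2.2.2.2.1 (f ω.1, ω.2.2.1, ω.2.2.2.2.1))) =
        p ω * (Real.log (V₁ ω.2.2.2.2.2.1.2 ω.2.2.2.2.2.2.2.1.2) -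
          Real.log (qy ω.2.2.2.2.2.2.2.1.2)) +
        p ω * -Real.log (sharedGuess (pX₂ (o₂, ω.2.2.2.2.1, ω.2.2.1)) ω.2.2.2.2.2.2.2.1.1) := by
      intro ω
      rcases (hp0 ω).eq_or_lt with h | h
      · simp [← h]
      · simp only [hr]
        rw [Real.log_mul (hqypos ω h).ne' (sharedGuess_pos (hX₂ _).1 _).ne']
        ring
    simp only [hsplit, Finset.sum_add_distrib]
    refine add_le_add ?_ ?_
    · have h1 := sum_mul_comp p (fun ω => (ω.2.2.2.2.2.1.2, ω.2.2.2.2.2.2.2.1.2))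
        fun z => Real.log (V₁ z.1 z.2) - Real.log (qy z.2)
      refine h1.le.trans ?_
      rw [Fintype.sum_prod_type]
      simp only [hxy]
      rw [← mutualInfo_channel hV₁ hpx0]
      exact mutualInfo_le_capacity hV₁ ⟨hpx0, hpx1⟩
    · refine le_trans (le_of_eq ?_)
        (sum_lcInput_shared_cost_le hP hQ hW₁ hW₂ hX₁ hX₂ o₁ o₂)
      have h1 := sum_lcJoint (P := P) (pQ := pQ) (pW₁ := pW₁) (pW₂ := pW₂) (pX₁ := pX₁)
        (pX₂ := pX₂) (V₁ := V₁) hV₂ fun z y =>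
          -Real.log (sharedGuess (pX₂ (o₂, z.2.2.2.2.1, z.2.2.1)) y.1)
      simp only [← Finset.sum_mul, (hV₁ _).2, one_mul] at h1
      exact h1

end Converse

section DueckSource

variable {η a k : ℕ}

lemma two_le_pow (ha : 2 ≤ a) {n : ℕ} (hn : n ≠ 0) : (2 : ℝ) ≤ (a : ℝ) ^ n := by
  have h : (2 : ℝ) ≤ a := by exact_mod_cast ha
  exact h.trans (le_self_pow₀ (by linarith) hn)

lemma dueckSource_diag_pos (ha : 2 ≤ a) (hk : 2 ≤ k) (hη : η ≠ 0) (c : Fin k → Fin a) :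
    0 < dueckSource η a k (c, c) := by
  have hk0 : k ≠ 0 := by omega
  have h1 := two_le_pow ha hk0
  have h2 := two_le_pow ha (mul_ne_zero hη hk0)
  have h3 : (2 : ℝ) ≤ k := by exact_mod_cast hk
  have h4 : (0 : ℝ) < (a : ℝ) ^ k - 1 := by linarith
  have h5 : (0 : ℝ) < (a : ℝ) ^ (η * k) - 1 := by linarith
  have h6 : (0 : ℝ) < (k : ℝ) - 1 := by linarith
  simp only [dueckSource, if_true]
  split_ifs <;> positivity

variable [NeZero a]

lemma forall_val_eq_zero_iff (c : Fin k → Fin a) : (∀ i, (c i : ℕ) = 0) ↔ c = 0 := by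
  rw [funext_iff]
  exact forall_congr' fun i => by rw [Pi.zero_apply, Fin.ext_iff, Fin.val_zero]

/-- Expectations under the source law. -/
lemma sum_dueckSource (F : (Fin k → Fin a) × (Fin k → Fin a) → ℝ) :
    ∑ s, dueckSource η a k s * F s = ((k : ℝ) - 1) / k * F (0, 0) +
      ∑ d with d ≠ 0,
        (((a : ℝ) ^ (η * k) - 1) / (k * (a : ℝ) ^ (η * k) * ((a : ℝ) ^ k - 1)) * F (d, d) +
          1 / (k * (a : ℝ) ^ (η * k) * ((a : ℝ) ^ k - 1)) * F (0, d)) := by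
  have h : ∀ c d : Fin k → Fin a, dueckSource η a k (c, d) * F (c, d) =
      (if c = 0 then if d = 0 then ((k : ℝ) - 1) / k * F (0, 0) else 0 else 0) +
      ((if c = d then if d ≠ 0 then
        ((a : ℝ) ^ (η * k) - 1) / (k * (a : ℝ) ^ (η * k) * ((a : ℝ) ^ k - 1)) * F (d, d)
          else 0 else 0) +
      (if c = 0 then if d ≠ 0 then
        1 / (k * (a : ℝ) ^ (η * k) * ((a : ℝ) ^ k - 1)) * F (0, d) else 0 else 0)) := by
    intro c d
    simp only [dueckSource, forall_val_eq_zero_iff]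
    by_cases hcd : c = d
    · subst hcd
      by_cases hc : c = 0 <;> simp [hc]
    · by_cases hc : c = 0
      · subst hc
        simp [hcd, Ne.symm hcd]
      · simp [hcd, hc]
  rw [Fintype.sum_prod_type_right]
  simp only [h, Finset.sum_add_distrib, Finset.sum_ite_eq', Finset.mem_univ, if_true]
  simp only [Finset.sum_filter]

lemma card_ne_zero_word : ((Finset.univ.filter fun d : Fin k → Fin a => d ≠ 0).card : ℝ) =
    (a : ℝ) ^ k - 1 := by
  rw [Finset.filter_ne', Finset.card_erase_of_mem (Finset.mem_univ _), Finset.card_univ,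
    Fintype.card_fun, Fintype.card_fin, Fintype.card_fin, Nat.cast_sub, Nat.cast_pow, Nat.cast_one]
  exact Nat.one_le_pow _ _ (Nat.pos_of_ne_zero (NeZero.ne a))

lemma dueckSource_mem (ha : 2 ≤ a) (hk : k ≠ 0) (hη : η ≠ 0) :
    dueckSource η a k ∈ stdSimplex ℝ ((Fin k → Fin a) × (Fin k → Fin a)) := by
  have h1 := two_le_pow ha hk
  have h2 := two_le_pow ha (mul_ne_zero hη hk)
  have h3 : (1 : ℝ) ≤ k := by exact_mod_cast Nat.one_le_iff_ne_zero.2 hk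
  have h4 : (0 : ℝ) ≤ (a : ℝ) ^ k - 1 := by linarith
  have h5 : (0 : ℝ) ≤ (a : ℝ) ^ (η * k) - 1 := by linarith
  have h6 : (0 : ℝ) ≤ (k : ℝ) - 1 := by linarith
  refine ⟨fun ⟨c, d⟩ => ?_, ?_⟩
  · simp only [dueckSource]
    split_ifs <;> positivity
  · have := sum_dueckSource (η := η) (a := a) (k := k) fun _ => 1
    simp only [mul_one, Finset.sum_const, nsmul_eq_mul] at this
    rw [this, card_ne_zero_word]
    have h7 : (a : ℝ) ^ k - 1 ≠ 0 := by linarith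
    field_simp
    ring

lemma dueckSource_zero : dueckSource η a k (0, 0) = ((k : ℝ) - 1) / k := by
  simp [dueckSource]

lemma dueckSource_zero_left_pos (ha : 2 ≤ a) (hk : k ≠ 0) {d : Fin k → Fin a} (hd : d ≠ 0) :
    0 < dueckSource η a k (0, d) := by
  have h1 := two_le_pow ha hk
  have h4 : (0 : ℝ) < (a : ℝ) ^ k - 1 := by linarith
  have h5 : (0 : ℝ) < a := by exact_mod_cast (by omega : 0 < a)
  have h6 : (0 : ℝ) < k := by exact_mod_cast Nat.pos_of_ne_zero hk
  simp only [dueckSource, if_neg hd.symm]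
  simp only [Pi.zero_apply, Fin.val_zero, implies_true, if_true]
  positivity

/-- The sources have no common part. -/
lemma commonFunction_eq {κ : Type*} (ha : 2 ≤ a) (hk : 2 ≤ k) (hη : η ≠ 0)
    {f g : (Fin k → Fin a) → κ} (h : ∀ s₁ s₂, 0 < dueckSource η a k (s₁, s₂) → f s₁ = g s₂)
    (d : Fin k → Fin a) : f d = f 0 := by
  by_cases hd : d = 0
  · rw [hd]
  · rw [h d d (dueckSource_diag_pos ha hk hη d),
      h 0 d (dueckSource_zero_left_pos ha (by omega) hd)]

/-- The entropy of the first source. -/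
lemma source_entropy_ge (ha : 2 ≤ a) (hk : 2 ≤ k) (hη : η ≠ 0) {Q : (Fin k → Fin a) → ℝ}
    (hQ : ∀ s, Q s = ∑ t, dueckSource η a k t * if t.1 = s then 1 else 0) :
    Real.log a / 2 - Real.log 2 / 2 ≤ ∑ s, dueckSource η a k s * -Real.log (Q s.1) := by
  have hk0 : k ≠ 0 := by omega
  have h1 := two_le_pow ha hk0
  have h2 := two_le_pow ha (mul_ne_zero hη hk0)
  have h3 : (2 : ℝ) ≤ k := by exact_mod_cast hk
  have hmem := dueckSource_mem ha hk0 hη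
  set N := (a : ℝ) ^ k with hN
  set A := (a : ℝ) ^ (η * k) with hA
  have hN1 : 0 < N - 1 := by linarith
  have hA1 : 0 < A - 1 := by linarith
  have hQd : ∀ d ≠ 0, Q d = (A - 1) / (k * A * (N - 1)) := by
    intro d hd
    rw [hQ, sum_dueckSource (fun t => if t.1 = d then 1 else 0)]
    simp [hd, hd.symm, hN, hA]
  have hQ0 : 0 ≤ -Real.log (Q 0) := by
    have hn : 0 ≤ Q 0 := by
      rw [hQ]
      exact Finset.sum_nonneg fun t _ => mul_nonneg (hmem.1 t) (by split_ifs <;> norm_num)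
    have hle : Q 0 ≤ 1 := by
      rw [hQ]
      refine le_trans ?_ hmem.2.le
      exact Finset.sum_le_sum fun t _ =>
        mul_le_of_le_one_right (hmem.1 t) (by split_ifs <;> norm_num)
    linarith [Real.log_nonpos hn hle]
  set α := (A - 1) / (k * A * (N - 1)) with hα
  have hα0 : 0 < α := by positivity
  have hαle : α ≤ 2 / N := by
    rw [hα, div_le_div_iff₀ (by positivity) (by positivity)]
    have e1 : N ≤ 2 * (N - 1) := by linarith
    have e2 : A - 1 ≤ k * A := by nlinarith
    calc (A - 1) * N ≤ (k * A) * (2 * (N - 1)) := by gcongr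
      _ = _ := by ring
  have hlog : k * Real.log a - Real.log 2 ≤ -Real.log α := by
    have := Real.log_le_log hα0 hαle
    rw [Real.log_div two_ne_zero (by linarith), hN, Real.log_pow] at this
    linarith
  have hlog2 : Real.log 2 ≤ Real.log a :=
    Real.log_le_log (by norm_num) (by exact_mod_cast ha)
  have hl2 : 0 ≤ Real.log 2 := Real.log_nonneg (by norm_num)
  rw [sum_dueckSource fun s => -Real.log (Q s.1)]
  have hsum : (N - 1) * (α * -Real.log α) ≤ ∑ d : Fin k → Fin a with d ≠ 0,
      (α * -Real.log (Q d) + 1 / (k * A * (N - 1)) * -Real.log (Q 0)) := by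
    have hcard : ∑ d : Fin k → Fin a with d ≠ 0, α * -Real.log α =
        (N - 1) * (α * -Real.log α) := by
      rw [Finset.sum_const, nsmul_eq_mul, card_ne_zero_word]
    rw [← hcard]
    refine Finset.sum_le_sum fun d hd => ?_
    rw [hQd d (Finset.mem_filter.1 hd).2]
    have : 0 ≤ 1 / (k * A * (N - 1)) * -Real.log (Q 0) := mul_nonneg (by positivity) hQ0
    linarith
  have hz : 0 ≤ ((k : ℝ) - 1) / k * -Real.log (Q 0) :=
    mul_nonneg (div_nonneg (by linarith) (by linarith)) hQ0
  refine le_trans ?_ (add_le_add hz hsum)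
  have hNα : 1 / (2 * k) ≤ (N - 1) * α := by
    have : (N - 1) * α = (A - 1) / (k * A) := by rw [hα]; field_simp
    rw [this, div_le_div_iff₀ (by positivity) (by positivity)]
    nlinarith
  have hkl : 0 ≤ k * Real.log a - Real.log 2 := by nlinarith
  calc Real.log a / 2 - Real.log 2 / 2 ≤ 1 / (2 * k) * (k * Real.log a - Real.log 2) := by
        have : 1 / (2 * k) * (k * Real.log a - Real.log 2) =
          Real.log a / 2 - Real.log 2 / (2 * k) := by field_simp
        rw [this]
        have : Real.log 2 / (2 * k) ≤ Real.log 2 / 2 := by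
          gcongr
          linarith
        linarith
    _ ≤ (N - 1) * α * -Real.log α := mul_le_mul hNα hlog hkl (by positivity)
    _ = 0 + (N - 1) * (α * -Real.log α) := by ring

end DueckSource

theorem not_LCConditions_dueck {η a k : ℕ} (hη : η ≠ 0) (ha : 3 ^ 20 ≤ a) (hk : 12 ≤ k)
    {X₁ X₂ Y₁ Y₂ : Type*} [Fintype X₁] [Fintype X₂] [Fintype Y₁] [Fintype Y₂]
    {V₁ : X₁ → Y₁ → ℝ} {V₂ : X₂ → Y₂ → ℝ} (hV₁ : IsChannel V₁) (hV₂ : IsChannel V₂)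
    (hC : capacity V₁ = Real.binEntropy (2 / k) + 2 / k * Real.log a) :
    ¬ LCConditions (dueckSource η a k) (dueckChannel a V₁ V₂) := by
  classical
  rintro ⟨nK, nQ, nW₁, nW₂, f, g, pQ, pW₁, pW₂, pX₁, pX₂, ⟨hfg, -⟩, hQ, hW₁, hW₂, hX₁, hX₂, hLC⟩
  have ha2 : 2 ≤ a := le_trans (by norm_num) ha
  have hk2 : 2 ≤ k := by omega
  have : NeZero a := ⟨by omega⟩
  have hf := commonFunction_eq ha2 hk2 hη hfg
  have hP := dueckSource_mem (η := η) ha2 (by omega : k ≠ 0) hη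
  have h1 := hLC.single_d1
  have h2 := condMutualInfo_lcJoint_le hP hQ hW₁ hW₂ hX₁ hX₂ hV₁ hV₂ f 0 0
  set p := lcJoint (dueckSource η a k) (dueckChannel a V₁ V₂) pQ pW₁ pW₂ pX₁ pX₂ with hp
  have hp1 : ∑ ω, p ω = 1 := by
    have := sum_lcJoint_source (P := dueckSource η a k) hQ hW₁ hW₂ hX₁ hX₂ hV₁ hV₂ fun _ => 1
    simpa [hP.2] using this
  have h3 : condEntropy p (fun ω => ω.1) (fun ω => f ω.1) =
      ∑ s, dueckSource η a k s * -Real.log (marg p (fun ω => ω.1) s.1) := by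
    rw [← sum_lcJoint_source (P := dueckSource η a k) hQ hW₁ hW₂ hX₁ hX₂ hV₁ hV₂
      fun s => -Real.log (marg p (fun ω => ω.1) s.1), condEntropy, entropy_eq_sum, entropy_eq_sum,
      ← Finset.sum_sub_distrib]
    refine Finset.sum_congr rfl fun ω _ => ?_
    have e1 : marg p (fun ω => f ω.1) (f ω.1) = 1 := by
      rw [marg_eq_sum p fun ω' => by rw [hf ω'.1, hf ω.1], hp1]
    have e2 : marg p (fun ω => (ω.1, f ω.1)) (ω.1, f ω.1) = marg p (fun ω => ω.1) ω.1 :=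
      marg_congr _ _ _ _ _ fun ω' => by
        simp only [Prod.mk.injEq, and_iff_left_iff_imp]
        exact fun h => by rw [h]
    rw [e1, e2]
    simp [hp]
  have h4 := source_entropy_ge ha2 hk2 hη (Q := marg p fun ω => ω.1) fun s => by
    rw [← sum_lcJoint_source (P := dueckSource η a k) hQ hW₁ hW₂ hX₁ hX₂ hV₁ hV₂
      fun t => if t.1 = s then 1 else 0, marg, Finset.sum_filter]
    simp [hp]
  rw [hC, dueckSource_zero] at h2
  have hk12 : (12 : ℝ) ≤ k := by exact_mod_cast hk
  have hb := Real.binEntropy_le_log_two (p := 2 / (k : ℝ))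
  have h1k : 1 / (k : ℝ) ≤ 1 / 12 := by gcongr
  have hl2 := Real.log_two_lt_d9
  have hl3 : Real.log 3 ≤ 2 := by linarith [Real.log_le_sub_one_of_pos (x := 3) (by norm_num)]
  have hl3' : 1 < Real.log 3 := by
    rw [Real.lt_log_iff_exp_lt (by norm_num)]
    linarith [Real.exp_one_lt_d9]
  have hla : 20 * Real.log 3 ≤ Real.log a := by
    have : Real.log ((3 : ℝ) ^ 20) ≤ Real.log a :=
      Real.log_le_log (by norm_num) (by exact_mod_cast ha)
    simpa using this
  have e1 : 2 / (k : ℝ) * Real.log a = 2 * (1 / k * Real.log a) := by ring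
  have e2 : (1 - ((k : ℝ) - 1) / k) * Real.log a = 1 / k * Real.log a := by
    field_simp
    ring
  have e3 : 1 / (k : ℝ) * Real.log a ≤ 1 / 12 * Real.log a := by
    gcongr
  rw [e1, e2] at h2
  have := h1.trans h2
  rw [h3] at this
  linarith

section RandomCoding

lemma prod_sum_eq_sum_prod {ι X : Type*} [Fintype ι] [DecidableEq ι] [Fintype X] (f : ι → X → ℝ) :
    ∏ i, ∑ x, f i x = ∑ c : ι → X, ∏ i, f i (c i) := by
  classical
  rw [Finset.prod_univ_sum, Fintype.piFinset_univ]

variable {S X : Type*} [Fintype S] [DecidableEq S] [Fintype X]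

lemma sum_codebook_pair {p : X → ℝ} (hp : ∑ x, p x = 1) {s s' : S} (h : s ≠ s') (f g : X → ℝ) :
    ∑ c : S → X, (∏ r, p (c r)) * (f (c s) * g (c s')) =
      (∑ x, p x * f x) * ∑ x, p x * g x := by
  have h1 : ∀ c : S → X, (∏ r, p (c r)) * (f (c s) * g (c s')) =
      ∏ r, p (c r) * ((if r = s then f (c r) else 1) * if r = s' then g (c r) else 1) := by
    intro c
    rw [Finset.prod_mul_distrib, Finset.prod_mul_distrib]
    simp
  simp only [h1]
  rw [← prod_sum_eq_sum_prod fun r x =>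
    p x * ((if r = s then f x else 1) * if r = s' then g x else 1)]
  rw [Finset.prod_eq_mul s s' h]
  · simp [h, h.symm]
  · rintro r - ⟨hs, hs'⟩
    simp [hs, hs', hp]
  · simp
  · simp

lemma sum_codebook_single {p : X → ℝ} (hp : ∑ x, p x = 1) (s : S) (f : X → ℝ) :
    ∑ c : S → X, (∏ r, p (c r)) * f (c s) = ∑ x, p x * f x := by
  have h1 : ∀ c : S → X, (∏ r, p (c r)) * f (c s) =
      ∏ r, p (c r) * if r = s then f (c r) else 1 := by
    intro c
    rw [Finset.prod_mul_distrib]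
    simp
  simp only [h1]
  rw [← prod_sum_eq_sum_prod fun r x => p x * if r = s then f x else 1]
  rw [Finset.prod_eq_single s]
  · simp
  · intro r _ hs
    simp [hs, hp]
  · simp

lemma min_one_le_rpow {R θ : ℝ} (hR : 0 < R) (h0 : 0 ≤ θ) (h1 : θ ≤ 1) : min 1 R ≤ R ^ θ := by
  rcases le_total 1 R with h | h
  · exact (min_le_left _ _).trans (Real.one_le_rpow h h0)
  · refine (min_le_right _ _).trans ?_
    simpa using Real.rpow_le_rpow_of_exponent_ge hR h h1

variable {Y T : Type*}

/-- The average over a random codebook of the probability that the source word `s` is received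
as `y` and some decoder maximizing `g · t * V (c ·) y` errs. -/
lemma sum_codebook_error_le {V : X → Y → ℝ} (hV : ∀ x y, 0 ≤ V x y) {p : X → ℝ}
    (hp : p ∈ stdSimplex ℝ X) {g : S → ℝ} (hg : ∀ s, 0 < g s) (hg1 : ∑ s, g s ≤ 1)
    {θ : ℝ} (h0 : 0 ≤ θ) (h1 : θ ≤ 1) (dec : (S → X) → S) (y : Y)
    (hdec : ∀ c s, g s * V (c s) y ≤ g (dec c) * V (c (dec c)) y) (s : S) :
    ∑ c : S → X, (∏ r, p (c r)) * (if dec c = s then 0 else V (c s) y) ≤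
      g s ^ (-θ) * ∑ x, p x * V x y * (V x y / ∑ x', p x' * V x' y) ^ (-θ) := by
  classical
  set q := ∑ x', p x' * V x' y with hq
  set w : (S → X) → ℝ := fun c => ∏ r, p (c r) with hw
  have hw0 : ∀ c, 0 ≤ w c := fun c => Finset.prod_nonneg fun r _ => hp.1 _
  set e : (S → X) → ℝ := fun c => if dec c = s then 0 else 1 with he
  have he0 : ∀ c, 0 ≤ e c := fun c => by simp only [he]; split_ifs <;> norm_num
  have he1 : ∀ c, e c ≤ 1 := fun c => by simp only [he]; split_ifs <;> norm_num
  set A : X → ℝ := fun x => ∑ c, w c * (e c * if c s = x then 1 else 0) with hA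
  have hsplit : ∑ c, w c * (if dec c = s then 0 else V (c s) y) = ∑ x, V x y * A x := by
    simp only [hA, Finset.mul_sum]
    rw [Finset.sum_comm]
    refine Finset.sum_congr rfl fun c _ => ?_
    rw [Finset.sum_eq_single (c s) (by intro x _ hx; simp [hx.symm]) (by simp)]
    simp only [he]
    split_ifs <;> simp [mul_comm]
  rw [hsplit, Finset.mul_sum]
  refine Finset.sum_le_sum fun x _ => ?_
  rcases (hV x y).eq_or_lt with hVx | hVx
  · simp [← hVx]
  have hA1 : A x ≤ p x := by
    calc A x ≤ ∑ c, w c * (if c s = x then 1 else 0) := by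
          refine Finset.sum_le_sum fun c _ => mul_le_mul_of_nonneg_left ?_ (hw0 c)
          exact mul_le_of_le_one_left (by split_ifs <;> norm_num) (he1 c)
      _ = p x := by
          rw [sum_codebook_single hp.2 s fun x' => if x' = x then 1 else 0]
          simp
  have hA2 : A x ≤ p x * (q / (g s * V x y)) := by
    have hpt : ∀ c, e c * (if c s = x then 1 else 0) ≤ ∑ s' ∈ Finset.univ.erase s,
        ((if c s = x then 1 else 0) * V (c s') y) * (g s' / (g s * V x y)) := by
      intro c
      have hterm : ∀ s' ∈ Finset.univ.erase s, (0 : ℝ) ≤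
          ((if c s = x then 1 else 0) * V (c s') y) * (g s' / (g s * V x y)) := fun s' _ =>
        mul_nonneg (mul_nonneg (by split_ifs <;> norm_num) (hV _ _))
          (div_nonneg (hg _).le (mul_pos (hg s) hVx).le)
      by_cases hc : c s = x
      · by_cases hd : dec c = s
        · simp only [he, hd, if_true, zero_mul]
          exact Finset.sum_nonneg hterm
        · refine le_trans ?_ (Finset.single_le_sum hterm
            (Finset.mem_erase.2 ⟨hd, Finset.mem_univ (dec c)⟩))
          have := hdec c s
          rw [hc] at this
          simp only [he, if_neg hd, if_pos hc, one_mul]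
          rw [mul_div_assoc', le_div_iff₀ (mul_pos (hg s) hVx)]
          linarith
      · simp only [if_neg hc, mul_zero]
        exact Finset.sum_nonneg (by simp)
    calc A x ≤ ∑ c, w c * ∑ s' ∈ Finset.univ.erase s,
          ((if c s = x then 1 else 0) * V (c s') y) * (g s' / (g s * V x y)) :=
        Finset.sum_le_sum fun c _ => mul_le_mul_of_nonneg_left (hpt c) (hw0 c)
      _ = ∑ s' ∈ Finset.univ.erase s, (p x * q) * (g s' / (g s * V x y)) := by
        simp only [Finset.mul_sum]
        rw [Finset.sum_comm]
        refine Finset.sum_congr rfl fun s' hs' => ?_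
        simp only [← mul_assoc]
        rw [← Finset.sum_mul]
        congr 1
        have := sum_codebook_pair hp.2 (Finset.ne_of_mem_erase hs').symm
          (fun x' => if x' = x then 1 else 0) (fun x' => V x' y)
        simp only [mul_assoc]
        rw [this]
        simp [hq]
      _ = (p x * q) / (g s * V x y) * ∑ s' ∈ Finset.univ.erase s, g s' := by
        rw [Finset.mul_sum (Finset.univ.erase s) g]
        exact Finset.sum_congr rfl fun _ _ => by ring
      _ ≤ (p x * q) / (g s * V x y) * 1 := by
        refine mul_le_mul_of_nonneg_left ?_ (div_nonneg (mul_nonneg (hp.1 x)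
          (Finset.sum_nonneg fun x' _ => mul_nonneg (hp.1 _) (hV _ _))) (mul_pos (hg s) hVx).le)
        exact (Finset.sum_le_sum_of_subset_of_nonneg (Finset.subset_univ _)
          fun _ _ _ => (hg _).le).trans hg1
      _ = _ := by ring
  rcases (hp.1 x).eq_or_lt with hpx | hpx
  · rw [← hpx] at hA1 ⊢
    simp only [zero_mul, mul_zero]
    exact mul_nonpos_of_nonneg_of_nonpos hVx.le hA1
  have hq0 : 0 < q := lt_of_lt_of_le (mul_pos hpx hVx)
    (Finset.single_le_sum (f := fun x' => p x' * V x' y)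
      (fun x' _ => mul_nonneg (hp.1 _) (hV _ _)) (Finset.mem_univ x))
  have hR : 0 < q / (g s * V x y) := div_pos hq0 (mul_pos (hg s) hVx)
  have hmin : A x ≤ p x * min 1 (q / (g s * V x y)) := by
    rw [mul_min_of_nonneg _ _ hpx.le, mul_one]
    exact le_min hA1 hA2
  have hpow : (q / (g s * V x y)) ^ θ = g s ^ (-θ) * (V x y / q) ^ (-θ) := by
    rw [← Real.mul_rpow (hg s).le (div_pos hVx hq0).le, Real.rpow_neg
      (mul_pos (hg s) (div_pos hVx hq0)).le, ← Real.inv_rpow (mul_pos (hg s) (div_pos hVx hq0)).le]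
    congr 1
    field_simp
  calc V x y * A x ≤ V x y * (p x * (q / (g s * V x y)) ^ θ) := by
        gcongr
        exact hmin.trans (mul_le_mul_of_nonneg_left (min_one_le_rpow hR h0 h1) hpx.le)
    _ = _ := by
        rw [hpow]
        ring

/-- Joint source-channel coding with side information `t` at the decoder: a random code with
maximum-metric decoding, for an arbitrary conditional law `g` of the source given `t`. -/
theorem exists_code {Ω : Type*} [Fintype Ω] [Fintype Y] [Nonempty S] {μ : Ω → ℝ} (hμ : ∀ ω, 0 ≤ μ ω)
    (s : Ω → S) (t : Ω → T) {V : X → Y → ℝ} (hV : ∀ x y, 0 ≤ V x y) {p : X → ℝ}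
    (hp : p ∈ stdSimplex ℝ X) {g : S → T → ℝ} (hg : ∀ s t, 0 < g s t)
    (hg1 : ∀ t, ∑ s, g s t ≤ 1) {θ : ℝ} (h0 : 0 ≤ θ) (h1 : θ ≤ 1) :
    ∃ (enc : S → X) (dec : T → Y → S),
      ∑ ω, μ ω * ∑ y, (if dec (t ω) y = s ω then 0 else V (enc (s ω)) y) ≤
        (∑ ω, μ ω * g (s ω) (t ω) ^ (-θ)) *
          ∑ y, ∑ x, p x * V x y * (V x y / ∑ x', p x' * V x' y) ^ (-θ) := by
  have hmax : ∀ (c : S → X) (t : T) (y : Y), ∃ s', ∀ s, g s t * V (c s) y ≤ g s' t * V (c s') y :=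
    fun c t y => Finite.exists_max fun s => g s t * V (c s) y
  choose dec hdec using hmax
  set w : (S → X) → ℝ := fun c => ∏ r, p (c r) with hw
  have hw0 : ∀ c, 0 ≤ w c := fun c => Finset.prod_nonneg fun r _ => hp.1 _
  have hw1 : ∑ c, w c = 1 := by
    rw [hw, ← prod_sum_eq_sum_prod fun _ x => p x]
    simp [hp.2]
  set B := (∑ ω, μ ω * g (s ω) (t ω) ^ (-θ)) *
    ∑ y, ∑ x, p x * V x y * (V x y / ∑ x', p x' * V x' y) ^ (-θ) with hB
  set E : (S → X) → ℝ := fun c =>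
    ∑ ω, μ ω * ∑ y, (if dec c (t ω) y = s ω then 0 else V (c (s ω)) y) with hE
  have havg : ∑ c, w c * E c ≤ B := by
    calc ∑ c, w c * E c = ∑ ω, μ ω * ∑ y, ∑ c,
          w c * (if dec c (t ω) y = s ω then 0 else V (c (s ω)) y) := by
          simp only [hE, Finset.mul_sum]
          rw [Finset.sum_comm]
          refine Finset.sum_congr rfl fun ω _ => ?_
          rw [Finset.sum_comm]
          exact Finset.sum_congr rfl fun _ _ => Finset.sum_congr rfl fun _ _ => by ring
      _ ≤ ∑ ω, μ ω * ∑ y, g (s ω) (t ω) ^ (-θ) *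
          ∑ x, p x * V x y * (V x y / ∑ x', p x' * V x' y) ^ (-θ) := by
          refine Finset.sum_le_sum fun ω _ => mul_le_mul_of_nonneg_left ?_ (hμ ω)
          exact Finset.sum_le_sum fun y _ => sum_codebook_error_le hV hp (fun s => hg s (t ω))
            (hg1 (t ω)) h0 h1 (fun c => dec c (t ω) y) y (fun c => hdec c (t ω) y) (s ω)
      _ = B := by
          simp only [← Finset.mul_sum, ← mul_assoc]
          rw [← Finset.sum_mul]
  by_contra! hcon
  have hlt : ∀ c, B < E c := fun c => hcon c (dec c)
  have hz : ∑ c, w c * (E c - B) ≤ 0 := by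
    simp only [mul_sub, Finset.sum_sub_distrib]
    rw [← Finset.sum_mul, hw1]
    linarith
  have hz' : ∀ c, w c = 0 := by
    intro c
    have h2 := Finset.sum_eq_zero_iff_of_nonneg
      (fun c _ => mul_nonneg (hw0 c) (sub_pos.2 (hlt c)).le) |>.1
      (le_antisymm hz (Finset.sum_nonneg fun c _ => mul_nonneg (hw0 c) (sub_pos.2 (hlt c)).le))
      c (Finset.mem_univ c)
    exact (mul_eq_zero.1 h2).resolve_right (sub_pos.2 (hlt c)).ne'
  simp [hz'] at hw1

end RandomCoding

/-- The expectation of the `-θ`-th power of the likelihood ratio of a channel. -/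
noncomputable def channelMoment {X Y : Type*} [Fintype X] [Fintype Y] (V : X → Y → ℝ) (p : X → ℝ)
    (θ : ℝ) : ℝ :=
  ∑ y, ∑ x, p x * V x y * (V x y / ∑ x', p x' * V x' y) ^ (-θ)

/-- Block codes for a memoryless channel. -/
theorem exists_block_code {Ω S T X Y : Type*} [Fintype Ω] [Fintype S] [DecidableEq S]
    [Fintype X] [Fintype Y] [Nonempty S] {μ : Ω → ℝ} (hμ : ∀ ω, 0 ≤ μ ω)
    (s : Ω → S) (t : Ω → T) {V : X → Y → ℝ} (hV : ∀ x y, 0 ≤ V x y) {p : X → ℝ}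
    (hp : p ∈ stdSimplex ℝ X) {g : S → T → ℝ} (hg : ∀ s t, 0 < g s t)
    (hg1 : ∀ t, ∑ s, g s t ≤ 1) {θ : ℝ} (h0 : 0 ≤ θ) (h1 : θ ≤ 1) (n : ℕ) :
    ∃ (enc : S → Fin n → X) (dec : T → (Fin n → Y) → S),
      ∑ ω, μ ω * ∑ y, (if dec (t ω) y = s ω then 0 else ∏ i, V (enc (s ω) i) (y i)) ≤
        (∑ ω, μ ω * g (s ω) (t ω) ^ (-θ)) * channelMoment V p θ ^ n := by
  have hpn : (fun x : Fin n → X => ∏ i, p (x i)) ∈ stdSimplex ℝ (Fin n → X) := by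
    refine ⟨fun x => Finset.prod_nonneg fun i _ => hp.1 _, ?_⟩
    rw [← prod_sum_eq_sum_prod fun _ x => p x]
    simp [hp.2]
  obtain ⟨enc, dec, h⟩ := exists_code hμ s t
    (V := fun (x : Fin n → X) (y : Fin n → Y) => ∏ i, V (x i) (y i))
    (fun x y => Finset.prod_nonneg fun i _ => hV _ _) hpn hg hg1 h0 h1
  refine ⟨enc, dec, h.trans_eq ?_⟩
  congr 1
  have hq : ∀ y : Fin n → Y, ∑ x : Fin n → X, (∏ i, p (x i)) * ∏ i, V (x i) (y i) =
      ∏ i, ∑ x, p x * V x (y i) := by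
    intro y
    rw [prod_sum_eq_sum_prod fun i x => p x * V x (y i)]
    simp [Finset.prod_mul_distrib]
  have hq0 : ∀ y, 0 ≤ ∑ x, p x * V x y := fun y =>
    Finset.sum_nonneg fun x _ => mul_nonneg (hp.1 _) (hV _ _)
  have hpt : ∀ (y : Fin n → Y) (x : Fin n → X), (∏ i, p (x i)) * (∏ i, V (x i) (y i)) *
      ((∏ i, V (x i) (y i)) / ∏ i, ∑ x', p x' * V x' (y i)) ^ (-θ) =
      ∏ i, (p (x i) * V (x i) (y i) * (V (x i) (y i) / ∑ x', p x' * V x' (y i)) ^ (-θ)) := by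
    intro y x
    rw [← Finset.prod_div_distrib, ← Real.finsetProd_rpow _ _ fun i _ =>
      div_nonneg (hV _ _) (hq0 _), Finset.prod_mul_distrib, Finset.prod_mul_distrib]
  simp only [hq, hpt]
  rw [channelMoment, ← Fin.prod_const, prod_sum_eq_sum_prod]
  refine Finset.sum_congr rfl fun y _ => ?_
  rw [prod_sum_eq_sum_prod fun i x =>
    p x * V x (y i) * (V x (y i) / ∑ x', p x' * V x' (y i)) ^ (-θ)]

section Exponent

lemma hasDerivAt_sum_rpow_neg {ι : Type*} [Fintype ι] {w c : ι → ℝ}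
    (h : ∀ i, w i ≠ 0 → 0 < c i) :
    HasDerivAt (fun θ : ℝ => ∑ i, w i * c i ^ (-θ)) (∑ i, w i * -Real.log (c i)) 0 := by
  refine HasDerivAt.fun_sum fun i _ => ?_
  by_cases hw : w i = 0
  · simpa [hw] using hasDerivAt_const (0 : ℝ) (0 : ℝ)
  · have h1 := ((hasDerivAt_neg (0 : ℝ)).const_rpow (h i hw)).const_mul (w i)
    simpa using h1

variable {X Y : Type*} [Fintype X] [Fintype Y] {V : X → Y → ℝ} {p : X → ℝ}

lemma likelihood_pos (hV : IsChannel V) (hp : p ∈ stdSimplex ℝ X) {x : X} {y : Y}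
    (h : p x * V x y ≠ 0) : 0 < V x y / ∑ x', p x' * V x' y := by
  have h1 : ∀ x', 0 ≤ p x' * V x' y := fun x' => mul_nonneg (hp.1 _) ((hV _).1 _)
  refine div_pos (((hV x).1 y).lt_of_ne' (right_ne_zero_of_mul h))
    (lt_of_lt_of_le ((h1 x).lt_of_ne' h) ?_)
  exact Finset.single_le_sum (f := fun x' => p x' * V x' y) (fun x' _ => h1 x') (Finset.mem_univ x)

lemma hasDerivAt_channelMoment (hV : IsChannel V) (hp : p ∈ stdSimplex ℝ X) :
    HasDerivAt (channelMoment V p)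
      (-mutualInfo (fun z : X × Y => p z.1 * V z.1 z.2) Prod.fst Prod.snd) 0 := by
  have h1 := hasDerivAt_sum_rpow_neg (w := fun z : Y × X => p z.2 * V z.2 z.1)
    (c := fun z => V z.2 z.1 / ∑ x', p x' * V x' z.1) fun z hz => likelihood_pos hV hp hz
  have h2 : (fun θ : ℝ => ∑ z : Y × X, p z.2 * V z.2 z.1 *
      (V z.2 z.1 / ∑ x', p x' * V x' z.1) ^ (-θ)) = channelMoment V p := by
    funext θ
    rw [Fintype.sum_prod_type, channelMoment]
  rw [h2] at h1
  convert h1 using 1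
  rw [mutualInfo_channel hV hp.1, Fintype.sum_prod_type_right, ← Finset.sum_neg_distrib]
  refine Finset.sum_congr rfl fun x _ => ?_
  rw [← Finset.sum_neg_distrib]
  refine Finset.sum_congr rfl fun y _ => ?_
  by_cases hz : p x * V x y = 0
  · simp [hz]
  · have h3 := (div_ne_zero_iff.1 (likelihood_pos hV hp hz).ne')
    rw [Real.log_div h3.1 h3.2]
    ring

lemma channelMoment_zero (hV : IsChannel V) (hp : p ∈ stdSimplex ℝ X) :
    channelMoment V p 0 = 1 := by
  rw [channelMoment, Finset.sum_comm]
  simp [← Finset.mul_sum, (hV _).2, hp.2]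

lemma channelMoment_nonneg (hV : IsChannel V) (hp : p ∈ stdSimplex ℝ X) (θ : ℝ) :
    0 ≤ channelMoment V p θ := by
  refine Finset.sum_nonneg fun y _ => Finset.sum_nonneg fun x _ => ?_
  have h1 : ∀ x', 0 ≤ p x' * V x' y := fun x' => mul_nonneg (hp.1 _) ((hV _).1 _)
  exact mul_nonneg (h1 x) (Real.rpow_nonneg
    (div_nonneg ((hV x).1 y) (Finset.sum_nonneg fun x' _ => h1 x')) _)

lemma exists_lt_one_of_hasDerivAt_neg {F : ℝ → ℝ} {F' : ℝ} (h : HasDerivAt F F' 0) (h0 : F 0 = 1)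
    (hF : F' < 0) : ∃ θ, 0 < θ ∧ θ ≤ 1 ∧ F θ < 1 := by
  have h1 := (hasDerivAt_iff_tendsto_slope.1 h).eventually (gt_mem_nhds hF)
  rw [eventually_nhdsWithin_iff, Metric.eventually_nhds_iff] at h1
  obtain ⟨δ, hδ, h2⟩ := h1
  have hm : 0 < min (δ / 2) 1 := lt_min (by linarith) one_pos
  refine ⟨min (δ / 2) 1, hm, min_le_right _ _, ?_⟩
  have h3 := h2 (y := min (δ / 2) 1) (by
    rw [Real.dist_eq, sub_zero, abs_of_pos hm]
    exact (min_le_left _ _).trans_lt (by linarith)) hm.ne'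
  rw [slope_def_field, sub_zero, h0, div_lt_iff₀ hm, zero_mul] at h3
  linarith

/-- If the capacity of `l` channel uses exceeds the expected code length `E (-log c)`, then some
input law and some exponent make the error bound of `l` channel uses smaller than one. -/
lemma exists_exponent {ι : Type*} [Fintype ι] {w c : ι → ℝ} (hw : ∑ i, w i = 1)
    (hc : ∀ i, w i ≠ 0 → 0 < c i) (hV : IsChannel V) {l : ℕ} (hl : 0 < l) (hX : Nonempty X)
    (h : ∑ i, w i * -Real.log (c i) < l * capacity V) :
    ∃ p ∈ stdSimplex ℝ X, ∃ θ : ℝ, 0 < θ ∧ θ ≤ 1 ∧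
      (∑ i, w i * c i ^ (-θ)) * channelMoment V p θ ^ l < 1 := by
  have hl' : (0 : ℝ) < l := by exact_mod_cast hl
  have h1 : (∑ i, w i * -Real.log (c i)) / l < capacity V := by
    rwa [div_lt_iff₀ hl', mul_comm]
  have : Nonempty (stdSimplex ℝ X) := by
    classical
    exact ⟨⟨Pi.single hX.some 1, single_mem_stdSimplex ℝ hX.some⟩⟩
  obtain ⟨⟨p, hp⟩, h2⟩ := exists_lt_of_lt_ciSup h1
  rw [div_lt_iff₀ hl', mul_comm] at h2
  refine ⟨p, hp, ?_⟩
  have hd := (hasDerivAt_sum_rpow_neg hc).mul ((hasDerivAt_channelMoment hV hp).pow l)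
  refine exists_lt_one_of_hasDerivAt_neg hd ?_ ?_
  · simp [channelMoment_zero hV hp, hw]
  · simp only [Pi.pow_apply, channelMoment_zero hV hp, neg_zero, Real.rpow_zero, mul_one, hw,
      one_pow, one_mul]
    change ∑ i, w i * -Real.log (c i) <
      l * mutualInfo (fun z : X × Y => p z.1 * V z.1 z.2) Prod.fst Prod.snd at h2
    linarith

end Exponent

section Scheme

variable {a : ℕ} {S : Type*}

/-- The output word of the shared channel when both users apply `u` to their source words. -/
def sharedWord {n : ℕ} (u : (Fin n → S) → Fin n → Fin a) (σ : Fin n → S × S) : Fin n → Fin a :=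
  fun i => sharedOut (u (fun j => (σ j).1) i) (u (fun j => (σ j).2) i)

/-- Some conditional law `g` of the source word selected by `pr`, given the output of the shared
channel, satisfies `E (g ^ (-θ)) ≤ G`. -/
def GuessMoment [Fintype S] (P : S × S → ℝ) (pr : S × S → S) {n : ℕ}
    (u : (Fin n → S) → Fin n → Fin a) (θ G : ℝ) : Prop :=
  ∃ g : (Fin n → S) → (Fin n → Fin a) → ℝ, (∀ s t, 0 < g s t) ∧ (∀ t, ∑ s, g s t ≤ 1) ∧
    ∑ σ : Fin n → S × S, (∏ i, P (σ i)) * g (fun i => pr (σ i)) (sharedWord u σ) ^ (-θ) ≤ G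

/-- The concatenation of two codes. -/
def appendCode {m n : ℕ} (u : (Fin m → S) → Fin m → Fin a) (v : (Fin n → S) → Fin n → Fin a) :
    (Fin (m + n) → S) → Fin (m + n) → Fin a :=
  fun s => Fin.append (u fun i => s (Fin.castAdd n i)) (v fun i => s (Fin.natAdd m i))

lemma sum_append {α : Type*} [Fintype α] {m n : ℕ} (f : (Fin m → α) → ℝ) (g : (Fin n → α) → ℝ) :
    ∑ s : Fin (m + n) → α, f (fun i => s (Fin.castAdd n i)) * g (fun i => s (Fin.natAdd m i)) =
      (∑ s, f s) * ∑ s, g s := by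
  rw [← (Fin.appendEquiv m n).sum_comp, Fintype.sum_prod_type, Finset.sum_mul_sum]
  simp [Fin.appendEquiv]

variable [Fintype S] {P : S × S → ℝ} {pr : S × S → S}

lemma GuessMoment.append (hP : ∀ s, 0 ≤ P s) {m n : ℕ} {u : (Fin m → S) → Fin m → Fin a}
    {v : (Fin n → S) → Fin n → Fin a} {θ G G' : ℝ} (h : GuessMoment P pr u θ G)
    (h' : GuessMoment P pr v θ G') : GuessMoment P pr (appendCode u v) θ (G * G') := by
  obtain ⟨g, hg0, hg1, hg⟩ := h
  obtain ⟨g', hg0', hg1', hg'⟩ := h'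
  refine ⟨fun s t => g (fun i => s (Fin.castAdd n i)) (fun i => t (Fin.castAdd n i)) *
    g' (fun i => s (Fin.natAdd m i)) (fun i => t (Fin.natAdd m i)),
    fun s t => mul_pos (hg0 _ _) (hg0' _ _), fun t => ?_, ?_⟩
  · rw [sum_append (fun s => g s fun i => t (Fin.castAdd n i))
      fun s => g' s fun i => t (Fin.natAdd m i)]
    exact mul_le_one₀ (hg1 _) (Finset.sum_nonneg fun s _ => (hg0' _ _).le) (hg1' _)
  · have hn : ∀ {l : ℕ} (σ : Fin l → S × S), 0 ≤ ∏ i, P (σ i) := fun σ =>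
      Finset.prod_nonneg fun i _ => hP _
    have hnn := Finset.sum_nonneg fun (σ : Fin m → S × S) (_ : σ ∈ Finset.univ) =>
      mul_nonneg (hn σ) (Real.rpow_nonneg (hg0 (fun i => pr (σ i)) (sharedWord u σ)).le (-θ))
    have hnn' := Finset.sum_nonneg fun (σ : Fin n → S × S) (_ : σ ∈ Finset.univ) =>
      mul_nonneg (hn σ) (Real.rpow_nonneg (hg0' (fun i => pr (σ i)) (sharedWord v σ)).le (-θ))
    refine le_trans (le_of_eq ?_) (mul_le_mul hg hg' hnn' (hnn.trans hg))
    rw [← sum_append]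
    refine Finset.sum_congr rfl fun σ _ => ?_
    have e1 : (fun i => sharedWord (appendCode u v) σ (Fin.castAdd n i)) =
        sharedWord u fun i => σ (Fin.castAdd n i) := by
      funext i
      simp [sharedWord, appendCode]
    have e2 : (fun i => sharedWord (appendCode u v) σ (Fin.natAdd m i)) =
        sharedWord v fun i => σ (Fin.natAdd m i) := by
      funext i
      simp [sharedWord, appendCode]
    dsimp only
    rw [e1, e2, Fin.prod_univ_add, Real.mul_rpow (hg0 _ _).le (hg0' _ _).le]
    ring

/-- The uniform guess. -/
lemma guessMoment_uniform [Nonempty S] (hP : ∑ s, P s = 1) {n : ℕ}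
    (u : (Fin n → S) → Fin n → Fin a) (θ : ℝ) :
    GuessMoment P pr u θ (((Fintype.card S : ℝ) ^ n) ^ θ) := by
  have hpos : (0 : ℝ) < (Fintype.card S : ℝ) ^ n := by positivity
  refine ⟨fun _ _ => ((Fintype.card S : ℝ) ^ n)⁻¹, fun _ _ => by positivity, fun t => ?_, ?_⟩
  · simp [hpos.ne']
  · rw [← Finset.sum_mul, ← prod_sum_eq_sum_prod fun _ s => P s, Real.inv_rpow hpos.le,
      Real.rpow_neg hpos.le]
    simp [hP]

/-- Repetition of a block code of length `l`, followed by `r` uncoded letters. -/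
lemma exists_repeated_code [Nonempty S] [NeZero a] (hP : P ∈ stdSimplex ℝ (S × S))
    {pr' : S × S → S} {l : ℕ} {u : (Fin l → S) → Fin l → Fin a} {θ θ' G G' : ℝ}
    (h : GuessMoment P pr u θ G) (h' : GuessMoment P pr' u θ' G') (r m : ℕ) :
    ∀ n, n = m * l + r → ∃ v : (Fin n → S) → Fin n → Fin a,
      GuessMoment P pr v θ (G ^ m * ((Fintype.card S : ℝ) ^ r) ^ θ) ∧
      GuessMoment P pr' v θ' (G' ^ m * ((Fintype.card S : ℝ) ^ r) ^ θ') := by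
  induction m with
  | zero =>
    intro n hn
    obtain rfl : n = r := by omega
    refine ⟨fun _ _ => 0, ?_, ?_⟩
    · simpa using guessMoment_uniform (pr := pr) hP.2 (fun _ _ => 0) θ
    · simpa using guessMoment_uniform (pr := pr') hP.2 (fun _ _ => 0) θ'
  | succ m ih =>
    intro n hn
    obtain rfl : n = l + (m * l + r) := by rw [hn]; ring
    obtain ⟨v, hv, hv'⟩ := ih _ rfl
    refine ⟨appendCode u v, ?_, ?_⟩
    · rw [pow_succ', mul_assoc]
      exact h.append hP.1 hv
    · rw [pow_succ', mul_assoc]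
      exact h'.append hP.1 hv'

end Scheme

section Assembly

variable {a : ℕ} {S : Type*} [Fintype S] {P : S × S → ℝ}
  {X₁ X₂ Y₁ Y₂ : Type*} [Fintype Y₁] [Fintype Y₂]
  {V₁ : X₁ → Y₁ → ℝ} {V₂ : X₂ → Y₂ → ℝ}

lemma sum_shared_word {n : ℕ} {Y : Type*} [Fintype Y] (t : Fin n → Fin a)
    (v : Fin n → Y → ℝ) (F : (Fin n → Fin a) → (Fin n → Y) → ℝ) :
    ∑ y : Fin n → Fin a × Y, F (fun i => (y i).1) (fun i => (y i).2) *
      ∏ i, (v i (y i).2 * if (y i).1 = t i then 1 else 0) =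
      ∑ y : Fin n → Y, F t y * ∏ i, v i (y i) := by
  classical
  rw [← (Equiv.arrowProdEquivProdArrow (Fin n) (fun _ => Fin a) fun _ => Y).symm.sum_comp,
    Fintype.sum_prod_type_right]
  refine Finset.sum_congr rfl fun y _ => ?_
  change ∑ t', F t' y * ∏ i, (v i (y i) * if t' i = t i then 1 else 0) = _
  simp only [Finset.prod_mul_distrib]
  rw [Finset.sum_eq_single t]
  · simp
  · intro t' _ ht
    obtain ⟨i, hi⟩ := Function.ne_iff.1 ht
    rw [Finset.prod_eq_zero (f := fun i => if t' i = t i then (1 : ℝ) else 0)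
      (Finset.mem_univ i) (if_neg hi)]
    simp
  · simp

open scoped Classical in
/-- The error probability is at most the sum of those of the two decoders, each of which sees the
shared word and the output of its satellite channel. -/
lemma errorProb_le (hP : ∀ s, 0 ≤ P s) (hV₁ : IsChannel V₁) (hV₂ : IsChannel V₂) {n : ℕ}
    (u : (Fin n → S) → Fin n → Fin a)
    (enc₁ : (Fin n → S) → Fin n → X₁) (enc₂ : (Fin n → S) → Fin n → X₂)
    (dec₁ : (Fin n → Fin a) → (Fin n → Y₁) → Fin n → S)
    (dec₂ : (Fin n → Fin a) → (Fin n → Y₂) → Fin n → S) :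
    errorProb P (dueckChannel a V₁ V₂) (fun s i => (u s i, enc₁ s i)) (fun s i => (u s i, enc₂ s i))
        (fun y => dec₁ (fun i => (y i).1) fun i => (y i).2)
        (fun y => dec₂ (fun i => (y i).1) fun i => (y i).2) ≤
      (∑ σ : Fin n → S × S, (∏ i, P (σ i)) * ∑ y : Fin n → Y₁,
        if dec₁ (sharedWord u σ) y = fun i => (σ i).1 then 0
        else ∏ i, V₁ (enc₁ (fun i => (σ i).1) i) (y i)) +
      ∑ σ : Fin n → S × S, (∏ i, P (σ i)) * ∑ y : Fin n → Y₂,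
        if dec₂ (sharedWord u σ) y = fun i => (σ i).2 then 0
        else ∏ i, V₂ (enc₂ (fun i => (σ i).2) i) (y i) := by
  rw [errorProb, ← Fintype.sum_prod_type',
    ← (Equiv.arrowProdEquivProdArrow (Fin n) (fun _ => S) fun _ => S).sum_comp,
    ← Finset.sum_add_distrib]
  refine Finset.sum_le_sum fun σ _ => ?_
  simp only [Equiv.arrowProdEquivProdArrow, Equiv.coe_fn_mk]
  set s₁ : Fin n → S := fun i => (σ i).1 with hs₁
  set s₂ : Fin n → S := fun i => (σ i).2 with hs₂
  have hPn : 0 ≤ ∏ i, P (σ i) := Finset.prod_nonneg fun i _ => hP _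
  set Wn : (Fin n → Fin a × Y₁) → (Fin n → Fin a × Y₂) → ℝ := fun y₁ y₂ =>
    ∏ i, dueckChannel a V₁ V₂ ((u s₁ i, enc₁ s₁ i), (u s₂ i, enc₂ s₂ i)) (y₁ i, y₂ i) with hWn
  have hWn0 : ∀ y₁ y₂, 0 ≤ Wn y₁ y₂ := fun y₁ y₂ => Finset.prod_nonneg fun i _ =>
    (isChannel_dueckChannel hV₁ hV₂ _).1 _
  have h1 : ∀ y₁, ∑ y₂, Wn y₁ y₂ =
      ∏ i, (V₁ (enc₁ s₁ i) (y₁ i).2 * if (y₁ i).1 = sharedWord u σ i then 1 else 0) := by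
    intro y₁
    rw [hWn, ← prod_sum_eq_sum_prod fun i y => dueckChannel a V₁ V₂
      ((u s₁ i, enc₁ s₁ i), (u s₂ i, enc₂ s₂ i)) (y₁ i, y)]
    simp only [sum_dueckChannel_right hV₂]
    rfl
  have h2 : ∀ y₂, ∑ y₁, Wn y₁ y₂ =
      ∏ i, (V₂ (enc₂ s₂ i) (y₂ i).2 * if (y₂ i).1 = sharedWord u σ i then 1 else 0) := by
    intro y₂
    rw [hWn, ← prod_sum_eq_sum_prod fun i y => dueckChannel a V₁ V₂
      ((u s₁ i, enc₁ s₁ i), (u s₂ i, enc₂ s₂ i)) (y, y₂ i)]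
    simp only [sum_dueckChannel_left hV₁]
    rfl
  have k1 := sum_shared_word (sharedWord u σ) (fun i => V₁ (enc₁ s₁ i))
    fun t y => if dec₁ t y = s₁ then 0 else 1
  have k2 := sum_shared_word (sharedWord u σ) (fun i => V₂ (enc₂ s₂ i))
    fun t y => if dec₂ t y = s₂ then 0 else 1
  simp only [← h1] at k1
  simp only [← h2] at k2
  simp only [ite_mul, zero_mul, one_mul] at k1 k2
  rw [← k1, ← k2, ← mul_add]
  calc _ ≤ ∑ y₁ : Fin n → Fin a × Y₁, ∑ y₂ : Fin n → Fin a × Y₂, (∏ i, P (σ i)) *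
        ((if dec₁ (fun i => (y₁ i).1) (fun i => (y₁ i).2) = s₁ then 0 else Wn y₁ y₂) +
         if dec₂ (fun i => (y₂ i).1) (fun i => (y₂ i).2) = s₂ then 0 else Wn y₁ y₂) := by
        refine Finset.sum_le_sum fun y₁ _ => Finset.sum_le_sum fun y₂ _ => ?_
        have hm := mul_nonneg hPn (hWn0 y₁ y₂)
        change (if dec₁ (fun i => (y₁ i).1) (fun i => (y₁ i).2) = s₁ ∧
          dec₂ (fun i => (y₂ i).1) (fun i => (y₂ i).2) = s₂ then 0
          else (∏ i, P (σ i)) * Wn y₁ y₂) ≤ _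
        by_cases c1 : dec₁ (fun i => (y₁ i).1) (fun i => (y₁ i).2) = s₁ <;>
        by_cases c2 : dec₂ (fun i => (y₂ i).1) (fun i => (y₂ i).2) = s₂
        · simp [c1, c2]
        · simp [c1, c2]
        · simp [c1, c2]
        · simp only [c1, c2, false_and, if_false, mul_add]
          linarith
    _ = _ := by
        simp only [← Finset.mul_sum, Finset.sum_add_distrib]
        congr 2
        · refine Finset.sum_congr rfl fun y₁ _ => ?_
          split_ifs <;> simp
        · rw [Finset.sum_comm]
          refine Finset.sum_congr rfl fun y₂ _ => ?_
          split_ifs <;> simp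

end Assembly

section Transmission

variable {a : ℕ} [NeZero a] {S : Type*} [Fintype S] [Nonempty S] {P : S × S → ℝ}
  {X₁ X₂ Y₁ Y₂ : Type*} [Fintype X₁] [Fintype X₂] [Fintype Y₁] [Fintype Y₂]
  {V₁ : X₁ → Y₁ → ℝ} {V₂ : X₂ → Y₂ → ℝ}

lemma error_bound_le {ρ K γ G θ : ℝ} {l n : ℕ} (hl : 0 < l) (hγ : 0 ≤ γ) {N : ℝ} (hN : 0 ≤ N)
    (hG : 0 ≤ G) (hρ : G * γ ^ l = ρ)
    (hK : K = ∑ r ∈ Finset.range l, (N ^ r) ^ θ * γ ^ r) :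
    G ^ (n / l) * (N ^ (n % l)) ^ θ * γ ^ n ≤ ρ ^ (n / l) * K := by
  have h1 : γ ^ n = (γ ^ l) ^ (n / l) * γ ^ (n % l) := by
    rw [← pow_mul, ← pow_add, Nat.div_add_mod]
  have h2 : (N ^ (n % l)) ^ θ * γ ^ (n % l) ≤ K := by
    rw [hK]
    exact Finset.single_le_sum (f := fun r => (N ^ r) ^ θ * γ ^ r)
      (fun r _ => by positivity) (Finset.mem_range.2 (Nat.mod_lt n hl))
  have h3 : 0 ≤ ρ := by
    rw [← hρ]
    positivity
  calc _ = ρ ^ (n / l) * ((N ^ (n % l)) ^ θ * γ ^ (n % l)) := by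
        rw [h1, ← hρ, mul_pow]
        ring
    _ ≤ _ := by gcongr

lemma eventually_pow_div_mul_le {ρ : ℝ} (K : ℝ) {l : ℕ} (hl : 0 < l) (h0 : 0 ≤ ρ) (h1 : ρ < 1)
    {ε : ℝ} (hε : 0 < ε) : ∀ᶠ n : ℕ in Filter.atTop, ρ ^ (n / l) * K ≤ ε := by
  have h := ((tendsto_pow_atTop_nhds_zero_of_lt_one h0 h1).comp
    (Nat.tendsto_div_const_atTop hl.ne')).mul_const K
  rw [zero_mul] at h
  exact (h.eventually (gt_mem_nhds hε)).mono fun n hn => hn.le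

/-- Sufficient condition for transmissibility: with the common block code `u` on the shared
channel, the satellite capacities suffice to describe each source given the shared output. -/
theorem transmissible_of_guess (hP : P ∈ stdSimplex ℝ (S × S)) (hV₁ : IsChannel V₁)
    (hV₂ : IsChannel V₂) (hX₁ : Nonempty X₁) (hX₂ : Nonempty X₂) {l : ℕ} (hl : 0 < l)
    (u : (Fin l → S) → Fin l → Fin a) {g₁ g₂ : (Fin l → S) → (Fin l → Fin a) → ℝ}
    (hg₁ : ∀ s t, 0 < g₁ s t) (hs₁ : ∀ t, ∑ s, g₁ s t ≤ 1)
    (hg₂ : ∀ s t, 0 < g₂ s t) (hs₂ : ∀ t, ∑ s, g₂ s t ≤ 1)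
    (h₁ : ∑ σ : Fin l → S × S, (∏ i, P (σ i)) *
      -Real.log (g₁ (fun i => (σ i).1) (sharedWord u σ)) < l * capacity V₁)
    (h₂ : ∑ σ : Fin l → S × S, (∏ i, P (σ i)) *
      -Real.log (g₂ (fun i => (σ i).2) (sharedWord u σ)) < l * capacity V₂) :
    Transmissible P (dueckChannel a V₁ V₂) := by
  classical
  intro ε hε
  have hw : ∑ σ : Fin l → S × S, ∏ i, P (σ i) = 1 := by
    rw [← prod_sum_eq_sum_prod fun _ s => P s]
    simp [hP.2]
  have hw0 : ∀ {n : ℕ} (σ : Fin n → S × S), 0 ≤ ∏ i, P (σ i) := fun σ =>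
    Finset.prod_nonneg fun i _ => hP.1 _
  obtain ⟨p₁, hp₁, θ₁, hθ₁, hθ₁', hρ₁⟩ := exists_exponent hw (fun σ _ => hg₁ _ _) hV₁ hl hX₁ h₁
  obtain ⟨p₂, hp₂, θ₂, hθ₂, hθ₂', hρ₂⟩ := exists_exponent hw (fun σ _ => hg₂ _ _) hV₂ hl hX₂ h₂
  set G₁ := ∑ σ : Fin l → S × S, (∏ i, P (σ i)) *
    g₁ (fun i => (σ i).1) (sharedWord u σ) ^ (-θ₁) with hG₁
  set G₂ := ∑ σ : Fin l → S × S, (∏ i, P (σ i)) *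
    g₂ (fun i => (σ i).2) (sharedWord u σ) ^ (-θ₂) with hG₂
  have hG₁0 : 0 ≤ G₁ := Finset.sum_nonneg fun σ _ =>
    mul_nonneg (hw0 σ) (Real.rpow_nonneg (hg₁ _ _).le _)
  have hG₂0 : 0 ≤ G₂ := Finset.sum_nonneg fun σ _ =>
    mul_nonneg (hw0 σ) (Real.rpow_nonneg (hg₂ _ _).le _)
  have hm₁ : GuessMoment P Prod.fst u θ₁ G₁ := ⟨g₁, hg₁, hs₁, le_rfl⟩
  have hm₂ : GuessMoment P Prod.snd u θ₂ G₂ := ⟨g₂, hg₂, hs₂, le_rfl⟩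
  have hγ₁ := channelMoment_nonneg hV₁ hp₁ θ₁
  have hγ₂ := channelMoment_nonneg hV₂ hp₂ θ₂
  filter_upwards [eventually_pow_div_mul_le _ hl (by positivity) hρ₁ (half_pos hε),
    eventually_pow_div_mul_le _ hl (by positivity) hρ₂ (half_pos hε)] with n hn₁ hn₂
  obtain ⟨v, ⟨f₁, hf₁, hf₁', hf₁G⟩, ⟨f₂, hf₂, hf₂', hf₂G⟩⟩ :=
    exists_repeated_code hP hm₁ hm₂ (n % l) (n / l) n (Nat.div_add_mod' n l).symm
  obtain ⟨enc₁, dec₁, hc₁⟩ := exists_block_code (fun σ : Fin n → S × S => hw0 σ)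
    (fun σ i => (σ i).1) (sharedWord v) (fun x y => (hV₁ x).1 y) hp₁ hf₁ hf₁' hθ₁.le hθ₁' n
  obtain ⟨enc₂, dec₂, hc₂⟩ := exists_block_code (fun σ : Fin n → S × S => hw0 σ)
    (fun σ i => (σ i).2) (sharedWord v) (fun x y => (hV₂ x).1 y) hp₂ hf₂ hf₂' hθ₂.le hθ₂' n
  refine ⟨_, _, _, _, (errorProb_le hP.1 hV₁ hV₂ v enc₁ enc₂ dec₁ dec₂).trans ?_⟩
  have b₁ := (mul_le_mul_of_nonneg_right hf₁G (pow_nonneg hγ₁ n)).trans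
    ((error_bound_le hl hγ₁ (Nat.cast_nonneg _) hG₁0 rfl rfl).trans hn₁)
  have b₂ := (mul_le_mul_of_nonneg_right hf₂G (pow_nonneg hγ₂ n)).trans
    ((error_bound_le hl hγ₂ (Nat.cast_nonneg _) hG₂0 rfl rfl).trans hn₂)
  have c₁ := hc₁.trans b₁
  have c₂ := hc₂.trans b₂
  rw [← add_halves ε]
  refine add_le_add ?_ ?_
  · convert c₁
  · convert c₂

end Transmission

section BlockCode

variable {a k l : ℕ} [NeZero a]

/-- The positions of the nonzero letters of a source word. -/
def nonzeroPattern (s : Fin l → Fin k → Fin a) : Fin l → Bool := fun i => decide (s i ≠ 0)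

/-- The number of marked positions. -/
def patternWeight (b : Fin l → Bool) : ℕ := (Finset.univ.filter fun i => b i = true).card

lemma card_nonzeroPattern_le (b : Fin l → Bool) :
    Fintype.card {s : Fin l → Fin k → Fin a // nonzeroPattern s = b} ≤
      a ^ (k * patternWeight b) := by
  classical
  have hsub : (Finset.univ.filter fun s : Fin l → Fin k → Fin a => nonzeroPattern s = b) ⊆
      Fintype.piFinset fun i => if b i then Finset.univ else {0} := by
    intro s hs
    rw [Finset.mem_filter] at hs
    rw [Fintype.mem_piFinset]
    intro i
    rw [← hs.2]
    by_cases h : s i = 0 <;> simp [nonzeroPattern, h]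
  rw [Fintype.card_subtype]
  refine (Finset.card_le_card hsub).trans ?_
  have hcard : ∀ i, (if b i then Finset.univ else ({0} : Finset (Fin k → Fin a))).card =
      if b i = true then a ^ k else 1 := by
    intro i
    split_ifs <;> simp
  rw [Fintype.card_piFinset]
  simp only [hcard]
  rw [Finset.prod_ite, Finset.prod_const, Finset.prod_const_one, mul_one, patternWeight, pow_mul]

/-- A map to channel words all of whose fibres, within the source words of a given pattern, are as
small as counting permits. -/
lemma exists_balanced_code : ∃ φ : (Fin l → Fin k → Fin a) → Fin l → Fin a, ∀ b t,
    (Finset.univ.filter fun s => nonzeroPattern s = b ∧ φ s = t).card ≤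
      a ^ (k * patternWeight b - l) := by
  classical
  have ha : 0 < a := Nat.pos_of_ne_zero (NeZero.ne a)
  have hemb : ∀ b : Fin l → Bool, Nonempty ({s : Fin l → Fin k → Fin a // nonzeroPattern s = b} ↪
      (Fin l → Fin a) × Fin (a ^ (k * patternWeight b - l))) := by
    intro b
    refine Function.Embedding.nonempty_of_card_le ((card_nonzeroPattern_le b).trans ?_)
    simp only [Fintype.card_prod, Fintype.card_fun, Fintype.card_fin]
    rw [← pow_add]
    exact Nat.pow_le_pow_right ha (by omega)
  let e := fun b => (hemb b).some
  refine ⟨fun s => (e (nonzeroPattern s) ⟨s, rfl⟩).1, fun b t => ?_⟩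
  rw [← Finset.card_range (a ^ (k * patternWeight b - l))]
  refine Finset.card_le_card_of_injOn (fun s => ((e (nonzeroPattern s) ⟨s, rfl⟩).2 : ℕ)) ?_ ?_
  · intro s hs
    simp only [Finset.mem_coe, Finset.mem_filter, Finset.mem_univ, true_and] at hs
    obtain ⟨rfl, -⟩ := hs
    simp
  · intro s hs s' hs' h
    simp only [Finset.mem_coe, Finset.mem_filter, Finset.mem_univ, true_and] at hs hs'
    obtain ⟨rfl, rfl⟩ := hs
    obtain ⟨hb, ht⟩ := hs'
    have key : ∀ (b : Fin l → Bool) (h1 : nonzeroPattern s = b) (h2 : nonzeroPattern s' = b),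
        (e (nonzeroPattern s) ⟨s, rfl⟩).1 = (e (nonzeroPattern s') ⟨s', rfl⟩).1 →
        ((e (nonzeroPattern s) ⟨s, rfl⟩).2 : ℕ) = (e (nonzeroPattern s') ⟨s', rfl⟩).2 →
        e b ⟨s, h1⟩ = e b ⟨s', h2⟩ := by
      rintro b rfl h2 hfst hsnd
      have h3 : ∀ (b' : Fin l → Bool) (hb' : nonzeroPattern s' = b'),
          (e b' ⟨s', hb'⟩).1 = (e (nonzeroPattern s') ⟨s', rfl⟩).1 ∧
          ((e b' ⟨s', hb'⟩).2 : ℕ) = (e (nonzeroPattern s') ⟨s', rfl⟩).2 := by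
        rintro b' rfl
        exact ⟨rfl, rfl⟩
      refine Prod.ext ?_ (Fin.ext ?_)
      · rw [hfst, (h3 _ h2).1]
      · rw [hsnd, (h3 _ h2).2]
    exact congrArg Subtype.val ((e _).injective (key _ rfl hb ht.symm h))

/-- The law of the pattern when letters are nonzero with probability `1 / k`. -/
noncomputable def patternProb (k : ℕ) (b : Fin l → Bool) : ℝ :=
  ∏ i, if b i then 1 / (k : ℝ) else 1 - 1 / k

lemma patternProb_pos (hk : 2 ≤ k) (b : Fin l → Bool) : 0 < patternProb k b := by
  have h : (2 : ℝ) ≤ k := by exact_mod_cast hk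
  refine Finset.prod_pos fun i _ => ?_
  split_ifs
  · positivity
  · rw [sub_pos, div_lt_one (by linarith)]
    linarith

lemma sum_patternProb (k : ℕ) : ∑ b : Fin l → Bool, patternProb k b = 1 := by
  have h := prod_sum_eq_sum_prod fun (_ : Fin l) (b : Bool) => if b then 1 / (k : ℝ) else 1 - 1 / k
  simp only [patternProb]
  rw [← h]
  simp

/-- A guess at the source word given the output `t` of the shared channel: most likely `t` is the
code word `φ s`, and otherwise nothing is assumed. -/
noncomputable def blockGuess (φ : (Fin l → Fin k → Fin a) → Fin l → Fin a)
    (s : Fin l → Fin k → Fin a) (t : Fin l → Fin a) : ℝ :=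
  ((if φ s = t then patternProb k (nonzeroPattern s) /
    (a : ℝ) ^ (k * patternWeight (nonzeroPattern s) - l) else 0) + (((a : ℝ) ^ k) ^ l)⁻¹) / 2

variable {φ : (Fin l → Fin k → Fin a) → Fin l → Fin a}

lemma natCast_pos_of_neZero : (0 : ℝ) < a := by
  exact_mod_cast Nat.pos_of_ne_zero (NeZero.ne a)

lemma inv_le_blockGuess (hk : 2 ≤ k) (s : Fin l → Fin k → Fin a) (t : Fin l → Fin a) :
    (((a : ℝ) ^ k) ^ l)⁻¹ / 2 ≤ blockGuess φ s t := by
  have ha := natCast_pos_of_neZero (a := a)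
  have h1 := patternProb_pos hk (nonzeroPattern s)
  have : 0 ≤ if φ s = t then patternProb k (nonzeroPattern s) /
    (a : ℝ) ^ (k * patternWeight (nonzeroPattern s) - l) else 0 := by
    split_ifs <;> positivity
  rw [blockGuess]
  linarith

lemma blockGuess_pos (hk : 2 ≤ k) (s : Fin l → Fin k → Fin a) (t : Fin l → Fin a) :
    0 < blockGuess φ s t := by
  have ha := natCast_pos_of_neZero (a := a)
  exact lt_of_lt_of_le (by positivity) (inv_le_blockGuess hk s t)

lemma sum_blockGuess_le (hk : 2 ≤ k)
    (hφ : ∀ b t, (Finset.univ.filter fun s => nonzeroPattern s = b ∧ φ s = t).card ≤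
      a ^ (k * patternWeight b - l)) (t : Fin l → Fin a) : ∑ s, blockGuess φ s t ≤ 1 := by
  have ha := natCast_pos_of_neZero (a := a)
  have h1 : ∑ s : Fin l → Fin k → Fin a, (((a : ℝ) ^ k) ^ l)⁻¹ = 1 := by
    have : ((a : ℝ) ^ k) ^ l ≠ 0 := by positivity
    simp [this]
  have h2 : ∑ s : Fin l → Fin k → Fin a, (if φ s = t then patternProb k (nonzeroPattern s) /
      (a : ℝ) ^ (k * patternWeight (nonzeroPattern s) - l) else 0) ≤ 1 := by
    rw [← sum_patternProb (l := l) k, ← Finset.sum_fiberwise Finset.univ nonzeroPattern]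
    refine Finset.sum_le_sum fun b _ => ?_
    rw [← Finset.sum_filter, Finset.filter_filter]
    calc _ = ∑ s : Fin l → Fin k → Fin a with nonzeroPattern s = b ∧ φ s = t,
          patternProb k b / (a : ℝ) ^ (k * patternWeight b - l) := by
          refine Finset.sum_congr rfl fun s hs => ?_
          rw [(Finset.mem_filter.1 hs).2.1]
      _ ≤ (a : ℝ) ^ (k * patternWeight b - l) *
          (patternProb k b / (a : ℝ) ^ (k * patternWeight b - l)) := by
          rw [Finset.sum_const, nsmul_eq_mul]
          refine mul_le_mul_of_nonneg_right (by exact_mod_cast hφ b t) ?_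
          have := patternProb_pos hk b
          positivity
      _ = patternProb k b := by field_simp
  simp only [blockGuess]
  rw [← Finset.sum_div, Finset.sum_add_distrib, h1]
  linarith

/-- The code length of a letter in the description of the pattern. -/
noncomputable def letterLength (d : Fin k → Fin a) : ℝ :=
  if d = 0 then -Real.log (1 - 1 / k) else -Real.log (1 / k)

lemma letterLength_nonneg (hk : 2 ≤ k) (d : Fin k → Fin a) : 0 ≤ letterLength d := by
  have h : (2 : ℝ) ≤ k := by exact_mod_cast hk
  have h1 : 1 / (k : ℝ) ≤ 1 := by rw [div_le_one (by linarith)]; linarith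
  have h0 : 0 ≤ 1 / (k : ℝ) := by positivity
  rw [letterLength]
  split_ifs
  · exact neg_nonneg.2 (Real.log_nonpos (by linarith) (by linarith))
  · exact neg_nonneg.2 (Real.log_nonpos h0 h1)

lemma neg_log_patternProb (hk : 2 ≤ k) (s : Fin l → Fin k → Fin a) :
    -Real.log (patternProb k (nonzeroPattern s)) = ∑ i, letterLength (s i) := by
  have h : (2 : ℝ) ≤ k := by exact_mod_cast hk
  have h1 : 1 / (k : ℝ) < 1 := by rw [div_lt_one (by linarith)]; linarith
  rw [patternProb, Real.log_prod, ← Finset.sum_neg_distrib]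
  · refine Finset.sum_congr rfl fun i _ => ?_
    by_cases hs : s i = 0 <;> simp [nonzeroPattern, letterLength, hs]
  · intro i _
    split_ifs
    · positivity
    · linarith

/-- The excess of the rate of a letter over the rate of the shared channel. -/
noncomputable def letterExcess (d : Fin k → Fin a) : ℝ := (if d = 0 then 0 else (k : ℝ)) - 1

lemma sum_letterExcess (s : Fin l → Fin k → Fin a) :
    ∑ i, letterExcess (s i) = k * patternWeight (nonzeroPattern s) - l := by
  simp only [letterExcess, Finset.sum_sub_distrib, Finset.sum_const, Finset.card_univ,
    Fintype.card_fin, nsmul_eq_mul, mul_one]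
  rw [patternWeight, Finset.sum_ite, Finset.sum_const_zero, zero_add, Finset.sum_const,
    nsmul_eq_mul, mul_comm]
  simp [nonzeroPattern]

lemma overflow_le (hk : 2 ≤ k) (s : Fin l → Fin k → Fin a) :
    ((k * patternWeight (nonzeroPattern s) - l : ℕ) : ℝ) ≤
      ((∑ i, letterExcess (s i)) ^ 2 / k ^ 2 + k ^ 2) / 2 := by
  have h : (2 : ℝ) ≤ k := by exact_mod_cast hk
  rw [sum_letterExcess]
  rcases le_total (k * patternWeight (nonzeroPattern s)) l with h1 | h1
  · rw [Nat.sub_eq_zero_of_le h1]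
    push_cast
    positivity
  · rw [Nat.cast_sub h1]
    push_cast
    set x := (k : ℝ) * patternWeight (nonzeroPattern s) - l
    have h2 : x ^ 2 / k ^ 2 = (x / k) ^ 2 := by rw [div_pow]
    have h3 : x = (x / k) * k := by field_simp
    rw [h2]
    nlinarith [sq_nonneg (x / k - k)]

/-- The code length of a block, for either source. -/
lemma neg_log_blockGuess_le (hk : 2 ≤ k) (σ : Fin l → (Fin k → Fin a) × (Fin k → Fin a))
    {s : Fin l → Fin k → Fin a} (hs : s = (fun i => (σ i).1) ∨ s = fun i => (σ i).2) :
    -Real.log (blockGuess φ s (sharedWord φ σ)) ≤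
      Real.log 2 + ∑ i, letterLength (σ i).2 +
        ((∑ i, letterExcess (σ i).2) ^ 2 / k ^ 2 + k ^ 2) / 2 * Real.log a +
        (∑ i, if (σ i).1 = (σ i).2 then 0 else 1) * (l * k * Real.log a) := by
  have ha := natCast_pos_of_neZero (a := a)
  have hlog : 0 ≤ Real.log a := Real.log_natCast_nonneg a
  have hlen : 0 ≤ ∑ i, letterLength (σ i).2 :=
    Finset.sum_nonneg fun i _ => letterLength_nonneg hk _
  have hind : ∀ i, (0 : ℝ) ≤ if (σ i).1 = (σ i).2 then 0 else 1 := fun i => by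
    split_ifs <;> norm_num
  by_cases hm : ∀ i, (σ i).1 = (σ i).2
  · have hs' : s = fun i => (σ i).2 := by
      rcases hs with rfl | rfl
      · exact funext hm
      · rfl
    have hfst : (fun i => (σ i).1) = fun i => (σ i).2 := funext hm
    have ht : sharedWord φ σ = φ s := by
      funext i
      rw [sharedWord, hfst, hs', sharedOut, if_pos rfl]
    have hge : patternProb k (nonzeroPattern s) /
        (a : ℝ) ^ (k * patternWeight (nonzeroPattern s) - l) / 2 ≤
        blockGuess φ s (sharedWord φ σ) := by
      rw [blockGuess, if_pos ht.symm]
      have : 0 < (((a : ℝ) ^ k) ^ l)⁻¹ := by positivity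
      linarith
    have hpp := patternProb_pos hk (nonzeroPattern s)
    have h1 := Real.log_le_log (by positivity) hge
    rw [Real.log_div (by positivity) two_ne_zero, Real.log_div hpp.ne' (by positivity),
      Real.log_pow] at h1
    have h2 := neg_log_patternProb hk s
    have h3 := mul_le_mul_of_nonneg_right (overflow_le hk s) hlog
    have h4 : 0 ≤ (∑ i, if (σ i).1 = (σ i).2 then (0 : ℝ) else 1) * (l * k * Real.log a) :=
      mul_nonneg (Finset.sum_nonneg fun i _ => hind i) (by positivity)
    simp only [hs'] at h1 h2 h3 ⊢
    linarith
  · push Not at hm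
    obtain ⟨i, hi⟩ := hm
    have h1 := Real.log_le_log (by positivity) (inv_le_blockGuess (φ := φ) hk s (sharedWord φ σ))
    rw [Real.log_div (by positivity) two_ne_zero, Real.log_inv, Real.log_pow, Real.log_pow] at h1
    have h2 : (1 : ℝ) ≤ ∑ i, if (σ i).1 = (σ i).2 then 0 else 1 := by
      refine le_trans ?_ (Finset.single_le_sum (fun i _ => hind i) (Finset.mem_univ i))
      rw [if_neg hi]
    have h3 : 1 * (l * k * Real.log a) ≤
        (∑ i, if (σ i).1 = (σ i).2 then (0 : ℝ) else 1) * (l * k * Real.log a) :=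
      mul_le_mul_of_nonneg_right h2 (by positivity)
    have h4 : 0 ≤ ((∑ i, letterExcess (σ i).2) ^ 2 / (k : ℝ) ^ 2 + k ^ 2) / 2 * Real.log a := by
      positivity
    linarith

end BlockCode

section Moments

variable {X : Type*} [Fintype X] {p : X → ℝ} {l : ℕ}

lemma sum_word_linear (hp : ∑ x, p x = 1) (f : X → ℝ) :
    ∑ c : Fin l → X, (∏ r, p (c r)) * ∑ i, f (c i) = l * ∑ x, p x * f x := by
  simp only [Finset.mul_sum]
  rw [Finset.sum_comm]
  simp only [sum_codebook_single hp]
  simp [Finset.mul_sum]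

lemma sum_word_sq (hp : ∑ x, p x = 1) {z : X → ℝ} (hz : ∑ x, p x * z x = 0) :
    ∑ c : Fin l → X, (∏ r, p (c r)) * (∑ i, z (c i)) ^ 2 = l * ∑ x, p x * z x ^ 2 := by
  have h : ∀ i j : Fin l, ∑ c : Fin l → X, (∏ r, p (c r)) * (z (c i) * z (c j)) =
      if i = j then ∑ x, p x * z x ^ 2 else 0 := by
    intro i j
    split_ifs with hij
    · subst hij
      rw [← sum_codebook_single hp i fun x => z x ^ 2]
      exact Finset.sum_congr rfl fun c _ => by rw [sq]
    · rw [sum_codebook_pair hp hij, hz, zero_mul]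
  calc _ = ∑ i, ∑ j, ∑ c : Fin l → X, (∏ r, p (c r)) * (z (c i) * z (c j)) := by
        simp only [sq, Finset.sum_mul_sum]
        simp only [Finset.mul_sum]
        rw [Finset.sum_comm]
        exact Finset.sum_congr rfl fun i _ => Finset.sum_comm
    _ = _ := by simp [h]

end Moments

section ExpectedLength

variable {η a k : ℕ} [NeZero a]

lemma sum_dueckSource_snd (ha : 2 ≤ a) (hk : k ≠ 0) (x y : ℝ) :
    ∑ s, dueckSource η a k s * (if s.2 = 0 then x else y) =
      (1 - 1 / (k : ℝ)) * x + 1 / k * y := by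
  have h1 := two_le_pow ha hk
  have h2 : (a : ℝ) ^ (η * k) ≠ 0 := by
    have := natCast_pos_of_neZero (a := a)
    positivity
  have h3 : (k : ℝ) ≠ 0 := by exact_mod_cast hk
  have h4 : (a : ℝ) ^ k - 1 ≠ 0 := by linarith
  rw [sum_dueckSource fun s => if s.2 = 0 then x else y]
  have h5 : ∀ d : Fin k → Fin a, d ∈ Finset.univ.filter (fun d => d ≠ 0) →
      ((a : ℝ) ^ (η * k) - 1) / (k * (a : ℝ) ^ (η * k) * ((a : ℝ) ^ k - 1)) *
        (if d = 0 then x else y) + 1 / (k * (a : ℝ) ^ (η * k) * ((a : ℝ) ^ k - 1)) *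
        (if d = 0 then x else y) = y / (k * ((a : ℝ) ^ k - 1)) := by
    intro d hd
    rw [if_neg (Finset.mem_filter.1 hd).2]
    field_simp
    ring
  rw [Finset.sum_congr rfl h5, Finset.sum_const, nsmul_eq_mul, card_ne_zero_word, if_pos rfl]
  field_simp

lemma sum_dueckSource_ne (ha : 2 ≤ a) (hk : k ≠ 0) :
    ∑ s, dueckSource η a k s * (if s.1 = s.2 then 0 else 1) =
      1 / (k * (a : ℝ) ^ (η * k)) := by
  have h1 := two_le_pow ha hk
  have h2 : (a : ℝ) ^ (η * k) ≠ 0 := by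
    have := natCast_pos_of_neZero (a := a)
    positivity
  have h3 : (k : ℝ) ≠ 0 := by exact_mod_cast hk
  have h4 : (a : ℝ) ^ k - 1 ≠ 0 := by linarith
  rw [sum_dueckSource fun s => if s.1 = s.2 then 0 else 1]
  have h5 : ∀ d : Fin k → Fin a, d ∈ Finset.univ.filter (fun d => d ≠ 0) →
      ((a : ℝ) ^ (η * k) - 1) / (k * (a : ℝ) ^ (η * k) * ((a : ℝ) ^ k - 1)) *
        (if d = d then 0 else 1) + 1 / (k * (a : ℝ) ^ (η * k) * ((a : ℝ) ^ k - 1)) *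
        (if 0 = d then 0 else 1) = 1 / (k * (a : ℝ) ^ (η * k) * ((a : ℝ) ^ k - 1)) := by
    intro d hd
    rw [if_pos rfl, if_neg (Finset.mem_filter.1 hd).2.symm]
    ring
  rw [Finset.sum_congr rfl h5, Finset.sum_const, nsmul_eq_mul, card_ne_zero_word, if_pos rfl]
  field_simp
  ring

lemma expected_length_le (ha : 2 ≤ a) (hk : 2 ≤ k) (hη : η ≠ 0) {l : ℕ}
    {φ : (Fin l → Fin k → Fin a) → Fin l → Fin a}
    {pr : (Fin k → Fin a) × (Fin k → Fin a) → Fin k → Fin a} (hpr : pr = Prod.fst ∨ pr = Prod.snd) :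
    ∑ σ : Fin l → (Fin k → Fin a) × (Fin k → Fin a), (∏ i, dueckSource η a k (σ i)) *
        -Real.log (blockGuess φ (fun i => pr (σ i)) (sharedWord φ σ)) ≤
      Real.log 2 + l * Real.binEntropy (1 / k) +
        (l * ((k : ℝ) - 1) / k ^ 2 + k ^ 2) / 2 * Real.log a +
        l * (1 / (k * (a : ℝ) ^ (η * k))) * (l * k * Real.log a) := by
  have hk0 : k ≠ 0 := by omega
  have hkR : (k : ℝ) ≠ 0 := by exact_mod_cast hk0
  have hP := dueckSource_mem (η := η) ha hk0 hη
  have hlen : ∑ s, dueckSource η a k s * letterLength s.2 = Real.binEntropy (1 / k) := by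
    simp only [letterLength]
    rw [sum_dueckSource_snd ha hk0, Real.binEntropy, Real.log_inv, Real.log_inv]
    ring
  have hmean : ∑ s, dueckSource η a k s * letterExcess s.2 = 0 := by
    have h : ∀ d : Fin k → Fin a, letterExcess d = if d = 0 then -1 else (k : ℝ) - 1 := fun d => by
      rw [letterExcess]
      split_ifs <;> ring
    simp only [h]
    rw [sum_dueckSource_snd ha hk0]
    field_simp
    ring
  have hvar : ∑ s, dueckSource η a k s * letterExcess s.2 ^ 2 = (k : ℝ) - 1 := by
    have h : ∀ d : Fin k → Fin a, letterExcess d ^ 2 = if d = 0 then 1 else ((k : ℝ) - 1) ^ 2 :=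
      fun d => by
        rw [letterExcess]
        split_ifs <;> ring
    simp only [h]
    rw [sum_dueckSource_snd ha hk0]
    field_simp
    ring
  have e0 : ∑ σ : Fin l → (Fin k → Fin a) × (Fin k → Fin a), ∏ i, dueckSource η a k (σ i) = 1 := by
    rw [← prod_sum_eq_sum_prod fun _ s => dueckSource η a k s]
    simp [hP.2]
  have e1 := sum_word_linear (l := l) hP.2 fun s => letterLength s.2
  have e2 := sum_word_sq (l := l) hP.2 hmean
  have e3 := sum_word_linear (l := l) hP.2 fun s => if s.1 = s.2 then 0 else 1
  rw [hlen] at e1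
  rw [hvar] at e2
  rw [sum_dueckSource_ne ha hk0] at e3
  calc _ ≤ ∑ σ : Fin l → (Fin k → Fin a) × (Fin k → Fin a), (∏ i, dueckSource η a k (σ i)) *
        (Real.log 2 + ∑ i, letterLength (σ i).2 +
        ((∑ i, letterExcess (σ i).2) ^ 2 / k ^ 2 + k ^ 2) / 2 * Real.log a +
        (∑ i, if (σ i).1 = (σ i).2 then 0 else 1) * (l * k * Real.log a)) := by
        refine Finset.sum_le_sum fun σ _ => mul_le_mul_of_nonneg_left
          (neg_log_blockGuess_le hk σ ?_) (Finset.prod_nonneg fun i _ => hP.1 _)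
        rcases hpr with rfl | rfl
        · exact Or.inl rfl
        · exact Or.inr rfl
    _ = ∑ σ : Fin l → (Fin k → Fin a) × (Fin k → Fin a),
        ((∏ i, dueckSource η a k (σ i)) * (Real.log 2 + k ^ 2 / 2 * Real.log a) +
          (∏ i, dueckSource η a k (σ i)) * (∑ i, letterLength (σ i).2) +
          (∏ i, dueckSource η a k (σ i)) * (∑ i, letterExcess (σ i).2) ^ 2 *
            (1 / k ^ 2 / 2 * Real.log a) +
          (∏ i, dueckSource η a k (σ i)) * (∑ i, if (σ i).1 = (σ i).2 then 0 else 1) *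
            (l * k * Real.log a)) := Finset.sum_congr rfl fun σ _ => by ring
    _ = _ := by
        rw [Finset.sum_add_distrib, Finset.sum_add_distrib, Finset.sum_add_distrib,
          ← Finset.sum_mul, ← Finset.sum_mul, ← Finset.sum_mul, e0, e1, e2, e3]
        ring

end ExpectedLength

lemma nonempty_of_capacity_ne_zero {X Y : Type*} [Fintype X] [Fintype Y] {V : X → Y → ℝ}
    (h : capacity V ≠ 0) : Nonempty X := by
  by_contra hX
  rw [not_nonempty_iff] at hX
  have : IsEmpty (stdSimplex ℝ X) := ⟨fun p => by simpa using p.2.2⟩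
  exact h (by rw [capacity, Real.iSup_of_isEmpty])

theorem transmissible_dueck {η a k : ℕ} (hη : 8 ≤ η) (ha : 2 ≤ a) (hk : 4 ≤ k)
    {X₁ X₂ Y₁ Y₂ : Type*} [Fintype X₁] [Fintype X₂] [Fintype Y₁] [Fintype Y₂]
    {V₁ : X₁ → Y₁ → ℝ} {V₂ : X₂ → Y₂ → ℝ} (hV₁ : IsChannel V₁) (hV₂ : IsChannel V₂)
    (hC₁ : Real.binEntropy (2 / k) + 2 / k * Real.log a ≤ capacity V₁)
    (hC₂ : Real.binEntropy (2 / k) + 2 / k * Real.log a ≤ capacity V₂) :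
    Transmissible (dueckSource η a k) (dueckChannel a V₁ V₂) := by
  have : NeZero a := ⟨by omega⟩
  have hk2 : 2 ≤ k := by omega
  have hkR : (4 : ℝ) ≤ k := by exact_mod_cast hk
  have hk0 : (0 : ℝ) < k := by linarith
  have hlog2 : Real.log 2 ≤ Real.log a :=
    Real.log_le_log (by norm_num) (by exact_mod_cast ha)
  have hlog : 0 < Real.log a := lt_of_lt_of_le (Real.log_pos (by norm_num)) hlog2
  have h2k : 2 / (k : ℝ) ≤ 1 / 2 := by
    rw [div_le_div_iff₀ hk0 two_pos]
    linarith
  have hb0 : 0 ≤ Real.binEntropy (2 / k) := Real.binEntropy_nonneg (by positivity) (by linarith)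
  have hCpos : 0 < Real.binEntropy (2 / k) + 2 / k * Real.log a := by positivity
  have hbin : Real.binEntropy (1 / k) ≤ Real.binEntropy (2 / k) := by
    have h12 : 1 / (k : ℝ) ≤ 2 / k := by gcongr; norm_num
    have h2k' : 2 / (k : ℝ) ≤ 2⁻¹ := h2k.trans (by norm_num)
    exact Real.binEntropy_strictMonoOn.monotoneOn ⟨by positivity, h12.trans h2k'⟩
      ⟨by positivity, h2k'⟩ h12
  have hA : (k : ℝ) ^ 6 ≤ (a : ℝ) ^ (η * k) := by
    have h1 : k ^ 6 ≤ a ^ (η * k) := by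
      calc k ^ 6 ≤ k ^ η := Nat.pow_le_pow_right (by omega) (by omega)
        _ ≤ (2 ^ k) ^ η := Nat.pow_le_pow_left k.lt_two_pow_self.le _
        _ ≤ (a ^ k) ^ η := Nat.pow_le_pow_left (Nat.pow_le_pow_left ha _) _
        _ = a ^ (η * k) := by rw [← pow_mul, mul_comm]
    exact_mod_cast h1
  obtain ⟨φ, hφ⟩ := exists_balanced_code (a := a) (k := k) (l := k ^ 3)
  have hlt : ∀ {pr : (Fin k → Fin a) × (Fin k → Fin a) → Fin k → Fin a},
      (pr = Prod.fst ∨ pr = Prod.snd) → ∀ C, Real.binEntropy (2 / k) + 2 / k * Real.log a ≤ C →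
      ∑ σ : Fin (k ^ 3) → (Fin k → Fin a) × (Fin k → Fin a), (∏ i, dueckSource η a k (σ i)) *
        -Real.log (blockGuess φ (fun i => pr (σ i)) (sharedWord φ σ)) < ((k ^ 3 : ℕ) : ℝ) * C := by
    intro pr hpr C hC
    refine (expected_length_le ha hk2 (by omega) hpr).trans_lt
      (lt_of_lt_of_le ?_ (mul_le_mul_of_nonneg_left hC (by positivity)))
    push_cast
    have e1 : ((k : ℝ) ^ 3 * (k - 1) / k ^ 2 + k ^ 2) / 2 ≤ k ^ 2 := by
      have : (k : ℝ) ^ 3 * (k - 1) / k ^ 2 = k * (k - 1) := by field_simp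
      rw [this]
      nlinarith
    have e2 : (k : ℝ) ^ 3 * (1 / (k * (a : ℝ) ^ (η * k))) * (k ^ 3 * k * Real.log a) ≤
        Real.log a := by
      have hApos : (0 : ℝ) < (a : ℝ) ^ (η * k) := lt_of_lt_of_le (by positivity) hA
      have : (k : ℝ) ^ 3 * (1 / (k * (a : ℝ) ^ (η * k))) * (k ^ 3 * k * Real.log a) =
          k ^ 6 / (a : ℝ) ^ (η * k) * Real.log a := by
        field_simp
      rw [this]
      exact mul_le_of_le_one_left hlog.le ((div_le_one hApos).2 hA)
    have e3 := mul_le_mul_of_nonneg_right e1 hlog.le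
    have e4 := mul_le_mul_of_nonneg_left hbin (by positivity : (0 : ℝ) ≤ (k : ℝ) ^ 3)
    have e5 : (k : ℝ) ^ 3 * (2 / k * Real.log a) = 2 * (k ^ 2 * Real.log a) := by
      field_simp
    have e6 : 16 * Real.log a ≤ (k : ℝ) ^ 2 * Real.log a := by
      refine mul_le_mul_of_nonneg_right ?_ hlog.le
      nlinarith
    rw [mul_add, e5]
    linarith
  exact transmissible_of_guess (dueckSource_mem ha (by omega) (by omega)) hV₁ hV₂
    (nonempty_of_capacity_ne_zero (hCpos.trans_le hC₁).ne')
    (nonempty_of_capacity_ne_zero (hCpos.trans_le hC₂).ne') (by positivity) φ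
    (fun s t => blockGuess_pos hk2 s t) (fun t => sum_blockGuess_le hk2 hφ t)
    (fun s t => blockGuess_pos hk2 s t) (fun t => sum_blockGuess_le hk2 hφ t)
    (hlt (Or.inl rfl) _ hC₁) (hlt (Or.inr rfl) _ hC₂)

section Erasure

/-- The erasure channel that delivers its input with probability `c`. -/
def erasureChannel (M : ℕ) (c : ℝ) (x : Fin M) : Option (Fin M) → ℝ
  | none => 1 - c
  | some y => if y = x then c else 0

lemma isChannel_erasureChannel {M : ℕ} {c : ℝ} (h0 : 0 ≤ c) (h1 : c ≤ 1) :
    IsChannel (erasureChannel M c) := by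
  intro x
  refine ⟨fun y => ?_, ?_⟩
  · cases y with
    | none => simpa [erasureChannel] using h1
    | some y =>
      simp only [erasureChannel]
      split_ifs <;> simp [h0]
  · simp [Fintype.sum_option, erasureChannel]

lemma mutualInfo_erasureChannel {M : ℕ} {c : ℝ} (h0 : 0 ≤ c) (h1 : c ≤ 1) {q : Fin M → ℝ}
    (hq : q ∈ stdSimplex ℝ (Fin M)) :
    mutualInfo (fun z : Fin M × Option (Fin M) => q z.1 * erasureChannel M c z.1 z.2)
      Prod.fst Prod.snd = c * ∑ x, q x * -Real.log (q x) := by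
  rw [mutualInfo_channel (isChannel_erasureChannel h0 h1) hq.1, Finset.mul_sum]
  refine Finset.sum_congr rfl fun x _ => ?_
  have e1 : ∑ x', q x' * erasureChannel M c x' none = 1 - c := by
    simp [erasureChannel, ← Finset.sum_mul, hq.2]
  have e2 : ∑ x', q x' * erasureChannel M c x' (some x) = q x * c := by
    simp [erasureChannel]
  have e3 : ∀ y ∈ Finset.univ, y ≠ x → q x * erasureChannel M c x (some y) *
      (Real.log (erasureChannel M c x (some y)) -
        Real.log (∑ x', q x' * erasureChannel M c x' (some y))) = 0 := by
    intro y _ hy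
    simp [erasureChannel, hy]
  rw [Fintype.sum_option, Finset.sum_eq_single_of_mem x (Finset.mem_univ x) e3, e1, e2]
  simp only [erasureChannel, if_true, sub_self, mul_zero, zero_add]
  by_cases hx : q x * c = 0
  · rcases mul_eq_zero.1 hx with h | h <;> simp [h]
  · rw [Real.log_mul (left_ne_zero_of_mul hx) (right_ne_zero_of_mul hx)]
    ring

lemma capacity_erasureChannel {M : ℕ} [NeZero M] {c : ℝ} (h0 : 0 ≤ c) (h1 : c ≤ 1) :
    capacity (erasureChannel M c) = c * Real.log M := by
  have hM : (0 : ℝ) < M := by exact_mod_cast Nat.pos_of_ne_zero (NeZero.ne M)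
  have hu : (fun _ : Fin M => (M : ℝ)⁻¹) ∈ stdSimplex ℝ (Fin M) :=
    ⟨fun _ => by positivity, by simp [hM.ne']⟩
  refine le_antisymm ?_ ?_
  · have : Nonempty (stdSimplex ℝ (Fin M)) := ⟨⟨_, hu⟩⟩
    refine ciSup_le fun ⟨q, hq⟩ => ?_
    refine (mutualInfo_erasureChannel h0 h1 hq).le.trans (mul_le_mul_of_nonneg_left ?_ h0)
    have h := entropy_le_log_card (p := q) hq.1 hq.2 (id : Fin M → Fin M)
    rw [entropy_eq_sum, Fintype.card_fin] at h
    refine le_trans (le_of_eq ?_) h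
    refine Finset.sum_congr rfl fun x _ => ?_
    have : marg q id (id x) = q x := by
      classical
      rw [marg, Finset.sum_filter]
      exact (Finset.sum_congr rfl fun y _ => by congr).trans (Fintype.sum_ite_eq' x q)
    rw [this]
  · refine le_trans (le_of_eq ?_) (mutualInfo_le_capacity (isChannel_erasureChannel h0 h1) hu)
    rw [mutualInfo_erasureChannel h0 h1 hu]
    simp [hM.ne']

/-- Every nonnegative number is the capacity of a channel. -/
lemma exists_channel_capacity {C : ℝ} (hC : 0 ≤ C) :
    ∃ (M : ℕ) (V : Fin M → Option (Fin M) → ℝ), IsChannel V ∧ capacity V = C := by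
  obtain ⟨M, hM⟩ := exists_nat_gt (Real.exp (C + 1))
  have hM0 : (0 : ℝ) < M := (Real.exp_pos _).trans hM
  have hlog : C + 1 ≤ Real.log M := (Real.le_log_iff_exp_le hM0).2 hM.le
  have hpos : 0 < Real.log M := by linarith
  have : NeZero M := ⟨by rintro rfl; simp at hM0⟩
  have h0 : 0 ≤ C / Real.log M := by positivity
  have h1 : C / Real.log M ≤ 1 := (div_le_one hpos).2 (by linarith)
  refine ⟨M, erasureChannel M (C / Real.log M), isChannel_erasureChannel h0 h1, ?_⟩
  rw [capacity_erasureChannel h0 h1]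
  field_simp

end Erasure

theorem not_LCConditions_and_transmissible_dueck {η : ℕ} (hη : 8 ≤ η) {a k : ℕ}
    (ha : 3 ^ 20 ≤ a) (hk : 12 ≤ k)
    {X₁ X₂ Y₁ Y₂ : Type*} [Fintype X₁] [Fintype X₂] [Fintype Y₁] [Fintype Y₂]
    {V₁ : X₁ → Y₁ → ℝ} {V₂ : X₂ → Y₂ → ℝ} (hV₁ : IsChannel V₁) (hV₂ : IsChannel V₂)
    (hC₁ : capacity V₁ = Real.binEntropy (2 / k) + 2 / k * Real.log a)
    (hC₂ : capacity V₂ = Real.binEntropy (2 / k) + 2 / k * Real.log a +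
      Real.binEntropy (2 / (k * (a : ℝ) ^ (η * k)))) :
    ¬ LCConditions (dueckSource η a k) (dueckChannel a V₁ V₂) ∧
      Transmissible (dueckSource η a k) (dueckChannel a V₁ V₂) := by
  have ha2 : 2 ≤ a := le_trans (by norm_num) ha
  have hkR : (12 : ℝ) ≤ k := by exact_mod_cast hk
  have hA : 2 ≤ (a : ℝ) ^ (η * k) := two_le_pow ha2 (mul_ne_zero (by omega) (by omega))
  have hb : 0 ≤ Real.binEntropy (2 / (k * (a : ℝ) ^ (η * k))) := by
    refine Real.binEntropy_nonneg (by positivity) ((div_le_one (by positivity)).2 ?_)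
    nlinarith
  exact ⟨not_LCConditions_dueck (by omega) ha hk hV₁ hV₂ hC₁,
    transmissible_dueck hη ha2 (by omega) hV₁ hV₂ hC₁.ge (by rw [hC₂]; linarith)⟩

theorem theorem1 :
    (¬ ∀ (S₁ S₂ X₁ X₂ Y₁ Y₂ : Type) [Fintype S₁] [Fintype S₂] [Fintype X₁] [Fintype X₂]
        [Fintype Y₁] [Fintype Y₂] (P : S₁ × S₂ → ℝ) (W : X₁ × X₂ → Y₁ × Y₂ → ℝ),
        P ∈ stdSimplex ℝ (S₁ × S₂) → IsChannel W → Transmissible P W → LCConditions P W) ∧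
    ∀ η : ℕ, 8 ≤ η → Even η →
      ∃ aStar kStar : ℕ, ∀ a k : ℕ, aStar ≤ a → kStar ≤ k →
        ∀ (X₁ X₂ Y₁ Y₂ : Type*) [Fintype X₁] [Fintype X₂] [Fintype Y₁] [Fintype Y₂]
          (V₁ : X₁ → Y₁ → ℝ) (V₂ : X₂ → Y₂ → ℝ), IsChannel V₁ → IsChannel V₂ →
          capacity V₁ = Real.binEntropy (2 / k) + 2 / k * Real.log a →
          capacity V₂ = Real.binEntropy (2 / k) + 2 / k * Real.log a +
            Real.binEntropy (2 / (k * (a : ℝ) ^ (η * k))) →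
          ¬ LCConditions (dueckSource η a k) (dueckChannel a V₁ V₂) ∧
          Transmissible (dueckSource η a k) (dueckChannel a V₁ V₂) := by
  refine ⟨fun h => ?_, fun η hη _ => ⟨3 ^ 20, 12, fun a k ha hk X₁ X₂ Y₁ Y₂ _ _ _ _ V₁ V₂ =>
    not_LCConditions_and_transmissible_dueck hη ha hk⟩⟩
  obtain ⟨a, ha⟩ : ∃ a : ℕ, 3 ^ 20 ≤ a := ⟨_, le_rfl⟩
  obtain ⟨k, hk⟩ : ∃ k : ℕ, 12 ≤ k := ⟨_, le_rfl⟩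
  have ha2 : 2 ≤ a := le_trans (by norm_num) ha
  have hkR : (12 : ℝ) ≤ k := by exact_mod_cast hk
  have : NeZero a := ⟨by omega⟩
  have hA : 2 ≤ (a : ℝ) ^ (8 * k) := two_le_pow ha2 (mul_ne_zero (by omega) (by omega))
  have hb₁ : 0 ≤ Real.binEntropy (2 / k) :=
    Real.binEntropy_nonneg (by positivity) ((div_le_one (by linarith)).2 (by linarith))
  have hb₂ : 0 ≤ Real.binEntropy (2 / (k * (a : ℝ) ^ (8 * k))) :=
    Real.binEntropy_nonneg (by positivity) ((div_le_one (by positivity)).2 (by nlinarith))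
  have hlog : 0 ≤ Real.log a := Real.log_natCast_nonneg a
  have hC : 0 ≤ Real.binEntropy (2 / k) + 2 / k * Real.log a := by positivity
  obtain ⟨M₁, V₁, hV₁, hC₁⟩ := exists_channel_capacity hC
  obtain ⟨M₂, V₂, hV₂, hC₂⟩ := exists_channel_capacity (add_nonneg hC hb₂)
  have hD := not_LCConditions_and_transmissible_dueck le_rfl ha hk hV₁ hV₂ hC₁ hC₂
  exact hD.1 (h _ _ _ _ _ _ _ _ (dueckSource_mem ha2 (by omega) (by omega))
    (isChannel_dueckChannel hV₁ hV₂) hD.2)
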